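/- For $|q|<1/27$ put $$I_{1,1}(q)=\sum_{d\ge 0}(-1)^d\frac{(3d)!}{(d!)^3}q^d={}_2F_1\!\left(\tfrac13,\tfrac23;1;-27q\right),\qquad J(q)=\sum_{d\ge 1}(-1)^d\frac{(3d)!}{(d!)^3}\Big(\sum_{s=d+1}^{3d}\frac1s\Big)q^d,$$ and define the modular coordinate of local $\mathbb P^2$ (a coordinate on the modular curve of $\Gamma(3)$) by $$\mathfrak q=\mathfrak q(q)=-q\exp\!\Big(\frac{3J(q)}{I_{1,1}(q)}\Big)=e^{2\pi i\tau}.$$ The genus-one free energy of local $\mathbb P^2$ is $$\mathcal F_1=-\tfrac1{12}\log q-\tfrac12\log I_{1,1}(q)-\tfrac1{12}\log(1+27q).$$ Let $\eta=\mathfrak q^{1/24}\prod_{n\ge1}(1-\mathfrak q^n)$ be Dedekind's eta function and $d=\theta_2\big(\tfrac{\pi}{6},\mathfrak q^{1/2}\big)^3$, where $\theta_2(z,p)=2\sum_{n\ge0}p^{(n+1/2)^2}\cos((2n+1)z)$ and the fractional powers of $\mathfrak q$ are $\mathfrak q^{r}=e^{2\pi i r\tau}$. Theorem. For $0<|q|<1/27$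 one has $I_{1,1}(q)\neq0$, $0<|\mathfrak q(q)|<1$ and $d(\mathfrak q)\,\eta^3(\mathfrak q)\neq0$, and, up to an additive constant, $$\mathcal F_1=-\tfrac16\log\big(d(\mathfrak q)\,\eta^3(\mathfrak q)\big).$$ That is, on every connected subset $U$ of the punctured disc $0<|q|<1/27$, for any continuous branches on $U$ of $\tau$ and of the logarithms involved, the difference of the two sides is constant on $U$. -/

import Mathlib

noncomputable section

namespace LocalP2

/-- The series `I_{1,1}(q) = ∑_{d ≥ 0} (-1)^d (3d)! / (d!)^3 q^d = ₂F₁(1/3, 2/3; 1; -27 q)`,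
with radius of convergence `1/27`. It equals `1 + q f'(q)` for the mirror map `Q = q e^{f(q)}`,
`f(q) = ∑_{d ≥ 1} (-1)^d 3 (3d-1)! / (d!)^3 q^d`. -/
def I11 (q : ℂ) : ℂ :=
  ∑' d : ℕ, (-1) ^ d * (((3 * d).factorial : ℂ) / (d.factorial : ℂ) ^ 3) * q ^ d

/-- The series `∑_{d ≥ 1} (-1)^d (3d)! / (d!)^3 (∑_{s = d+1}^{3d} 1/s) q^d`
(the term `d = 0` is zero, its inner sum being empty). -/
def J11 (q : ℂ) : ℂ :=
  ∑' d : ℕ, (-1) ^ d * (((3 * d).factorial : ℂ) / (d.factorial : ℂ) ^ 3) *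
    (∑ s ∈ Finset.Icc (d + 1) (3 * d), (1 : ℂ) / (s : ℂ)) * q ^ d

/-- The modular coordinate `𝔮 = -q exp (3 J11(q) / I_{1,1}(q))` as a function of `q`. -/
def modularCoord (q : ℂ) : ℂ := -q * Complex.exp (3 * J11 q / I11 q)

/-- Jacobi's `θ₂(z, p) = 2 ∑_{n ≥ 0} p^{(n+1/2)^2} cos ((2n+1) z)` with nome
`p = 𝔮^{1/2} = e^{π i τ}`. -/
def theta2 (z τ : ℂ) : ℂ :=
  2 * ∑' n : ℕ, Complex.exp (Real.pi * Complex.I * τ * ((n : ℂ) + 1 / 2) ^ 2) *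
    Complex.cos ((2 * (n : ℂ) + 1) * z)

/-- `d = θ₂(π/6, 𝔮^{1/2})^3`, as a function of `τ`, where `𝔮^{1/2} = e^{π i τ}`. -/
def dFun (τ : ℂ) : ℂ := theta2 (Real.pi / 6) τ ^ 3

/-- `ℓ` is a continuous branch of `log f` on `U`. -/
def IsLogOn (U : Set ℂ) (f ℓ : ℂ → ℂ) : Prop :=
  ContinuousOn ℓ U ∧ ∀ q ∈ U, Complex.exp (ℓ q) = f q

/-- `τ` is a continuous branch on `U` of the modular parameter, `e^{2 π i τ(q)} = 𝔮(q)`. -/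
def IsModularParameterOn (U : Set ℂ) (τ : ℂ → ℂ) : Prop :=
  ContinuousOn τ U ∧
    ∀ q ∈ U, Complex.exp (2 * Real.pi * Complex.I * τ q) = modularCoord q

/-- `F` is a branch on `U` of the genus-one free energy of local `ℙ²`,
`F₁ = -(1/12) log q - (1/2) log I_{1,1}(q) - (1/12) log (1 + 27 q)`. -/
def IsGenusOneFreeEnergyOn (U : Set ℂ) (F : ℂ → ℂ) : Prop :=
  ∃ a b c : ℂ → ℂ, IsLogOn U (fun q => q) a ∧ IsLogOn U I11 b ∧
    IsLogOn U (fun q => 1 + 27 * q) c ∧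
    ∀ q ∈ U, F q = -(1 / 12) * a q - (1 / 2) * b q - (1 / 12) * c q

end LocalP2

end

/-! Put x = -27q, so that I_{1,1} = F(x) with F = ₂F₁(1/3, 2/3; 1; x), and 𝔮 = (x/27) exp(G/F),
where F log x + G is the logarithmic solution of the same equation. Let E(𝔮) = ∏ (1 - 𝔮^k).
Everything rests on the identity x(1-x)F(x)^6 = 27 𝔮 E(𝔮)^6 E(𝔮^3)^6 on the unit disc
(`mul_hypF_pow_six`). Since η = 𝔮^{1/24} E(𝔮) and θ₂(π/6) = √3 𝔮^{1/8} E(𝔮^3), its right side is (d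
η^3)^2. Hence (d η^3)^2 = -27 q (1+27q) I_{1,1}^6, and a logarithm of this, divided by -12, is the
theorem; a continuous combination of logarithms whose exponential is constant is itself constant on
a connected set.

Near 0 the identity comes from Borwein's cubic theory. With b^3 = E(q)^9/E(q^3)^3, c^3 = 27q
E(q^3)^9/E(q)^3 and a^3 = b^3 + c^3, the inverse of x ↦ 𝔮 is q ↦ c^3/a^3, and F(c^3/a^3)^3 = a^3
(`hypF_nomeMod`); then x(1-x)F^6 = b^3 c^3. Both facts follow by comparing two cubic
transformations. On the analytic side, F(X(y)) = (1+2y)F(y^3) and 𝔮(y^3) = 𝔮(X(y))^3 for an explicit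
rational X, proved with Wronskians. On the product side, q and q^3 correspond to X(y) and y^3 for y
= c(q^3)/a(q^3); this uses Jacobi's series for E^3 and the product of E over the rotations of q by
cube roots of unity. The comparison ratios therefore transform simply under q ↦ q^3, and iterating q
↦ q^3 → 0 forces them to be 1.

The identity theorem extends the result to |x| < 1, once F has no zero there and |𝔮| ≤ |x|. Both
come from Kaluza's theorem: the coefficients of F are log-convex, so 1/F has bounded coefficients,
and G/F has nonnegative coefficients and is at most log 27 in modulus. -/

namespace LocalP2

open Filter Topology Finset

/-! ### Power series with bounded coefficients -/

/-- The sum of the power series with coefficients `c`. -/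
noncomputable def psum (c : ℕ → ℂ) (x : ℂ) : ℂ := ∑' n, c n * x ^ n

section PowerSeries

variable {c : ℕ → ℂ} {K : ℝ} {x : ℂ}

theorem summable_norm_of_bounded (hc : ∀ n, ‖c n‖ ≤ K) (hx : ‖x‖ < 1) :
    Summable fun n => ‖c n * x ^ n‖ := by
  refine Summable.of_nonneg_of_le (fun _ => norm_nonneg _) (fun n => ?_)
    ((summable_geometric_of_lt_one (norm_nonneg x) hx).mul_left K)
  rw [norm_mul, norm_pow]
  gcongr
  exact hc n

theorem hasSum_psum (hc : ∀ n, ‖c n‖ ≤ K) (hx : ‖x‖ < 1) :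
    HasSum (fun n => c n * x ^ n) (psum c x) :=
  (summable_norm_of_bounded hc hx).of_norm.hasSum

theorem psum_zero : psum c 0 = c 0 := by
  rw [psum, tsum_eq_single 0]
  · simp
  · intro n hn; simp [hn]

theorem hasDerivAt_psum (hc : ∀ n, ‖c n‖ ≤ K) (hx : ‖x‖ < 1) :
    HasDerivAt (psum c) (∑' n : ℕ, c n * (n * x ^ (n - 1))) x ∧
      Summable fun n : ℕ => c n * (n * x ^ (n - 1)) := by
  obtain ⟨r, hxr, hr1⟩ := exists_between hx
  have hr0 : 0 ≤ r := (norm_nonneg x).trans hxr.le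
  have hu : Summable fun n : ℕ => K * (n * r ^ (n - 1)) := by
    refine Summable.mul_left K ?_
    rw [← summable_nat_add_iff 1]
    have h1 := summable_pow_mul_geometric_of_norm_lt_one 1 (r := r)
      (by rwa [Real.norm_of_nonneg hr0])
    have h2 := summable_geometric_of_lt_one hr0 hr1
    refine (h1.add h2).congr fun n => ?_
    push_cast
    simp
    ring
  have hK : 0 ≤ K := (norm_nonneg _).trans (hc 0)
  have hb : ∀ (n : ℕ) (y : ℂ), y ∈ Metric.ball (0 : ℂ) r →
      ‖c n * (n * y ^ (n - 1))‖ ≤ K * (n * r ^ (n - 1)) := by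
    intro n y hy
    have hy' : ‖y‖ ≤ r := by simpa using (mem_ball_zero_iff.1 hy).le
    rw [norm_mul, norm_mul, norm_pow, Complex.norm_natCast]
    gcongr
    exact hc n
  have hxb : x ∈ Metric.ball (0 : ℂ) r := by simpa using hxr
  refine ⟨?_, .of_norm_bounded hu fun n => hb n x hxb⟩
  refine hasDerivAt_tsum_of_isPreconnected (g := fun n y => c n * y ^ n)
    (g' := fun n y => c n * (n * y ^ (n - 1))) hu Metric.isOpen_ball
    (convex_ball 0 r).isPreconnected (fun n y _ => ?_) hb hxb (hasSum_psum hc hx).summable hxb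
  simpa using (hasDerivAt_pow n y).const_mul (c n)

theorem hasSum_deriv_psum (hc : ∀ n, ‖c n‖ ≤ K) (hx : ‖x‖ < 1) :
    HasSum (fun n : ℕ => ((n : ℂ) + 1) * c (n + 1) * x ^ n) (deriv (psum c) x) := by
  obtain ⟨h1, h2⟩ := hasDerivAt_psum hc hx
  rw [h1.deriv]
  have h3 := (hasSum_nat_add_iff' 1).2 h2.hasSum
  simp only [range_one, sum_singleton, Nat.cast_zero, zero_mul, mul_zero, sub_zero] at h3
  refine h3.congr_fun fun n => ?_
  rw [Nat.add_sub_cancel]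
  push_cast
  ring

theorem differentiableAt_psum (hc : ∀ n, ‖c n‖ ≤ K) (hx : ‖x‖ < 1) :
    DifferentiableAt ℂ (psum c) x := (hasDerivAt_psum hc hx).1.differentiableAt

end PowerSeries

/-! ### The coefficients -/

/-- The coefficients `(1/3)_n (2/3)_n / n!^2` of `₂F₁(1/3, 2/3; 1; x)`. -/
noncomputable def hypCoeff (n : ℕ) : ℝ := ((3 * n).factorial : ℝ) / ((n.factorial : ℝ) ^ 3 * 27 ^ n)

/-- The numbers `3 (H_{3n} - H_n)`. -/
noncomputable def harmCoeff (n : ℕ) : ℝ := 3 * ∑ s ∈ Icc (n + 1) (3 * n), (1 : ℝ) / s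

theorem hypCoeff_zero : hypCoeff 0 = 1 := by simp [hypCoeff]

theorem harmCoeff_zero : harmCoeff 0 = 0 := by simp [harmCoeff]

theorem hypCoeff_pos (n : ℕ) : 0 < hypCoeff n := by unfold hypCoeff; positivity

theorem hypCoeff_succ (n : ℕ) :
    ((n : ℝ) + 1) ^ 2 * hypCoeff (n + 1) = ((n : ℝ) ^ 2 + n + 2 / 9) * hypCoeff n := by
  have h : ((3 * (n + 1)).factorial : ℝ) =
      (3 * n + 3) * (3 * n + 2) * (3 * n + 1) * (3 * n).factorial := by
    rw [show 3 * (n + 1) = 3 * n + 1 + 1 + 1 by ring]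
    simp only [Nat.factorial_succ]
    push_cast
    ring
  unfold hypCoeff
  rw [h, Nat.factorial_succ]
  have := Nat.factorial_ne_zero n
  push_cast
  field_simp
  ring

theorem hypCoeff_le_one (n : ℕ) : hypCoeff n ≤ 1 := by
  induction n with
  | zero => rw [hypCoeff_zero]
  | succ n ih =>
    have h := hypCoeff_succ n
    have := hypCoeff_pos n
    have hn : (0 : ℝ) ≤ n := n.cast_nonneg
    by_contra! hc
    nlinarith [mul_lt_mul_of_pos_left hc (by positivity : (0 : ℝ) < ((n : ℝ) + 1) ^ 2)]

/-- The ratio of consecutive coefficients, (n^2 + n + 2/9)/(n+1)^2, increases with n. The gap `k` is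
allowed because Kaluza's argument compares ratios at non-adjacent indices. -/
theorem hypCoeff_logConvex (n k : ℕ) :
    hypCoeff (n + 1) * hypCoeff (n + k) ≤ hypCoeff n * hypCoeff (n + k + 1) := by
  have h1 := hypCoeff_succ n
  have h2 := hypCoeff_succ (n + k)
  push_cast at h2
  have hn : (0 : ℝ) ≤ n := n.cast_nonneg
  have hk : (0 : ℝ) ≤ k := k.cast_nonneg
  have p1 : (0 : ℝ) < ((n : ℝ) + 1) ^ 2 := by positivity
  have p2 : (0 : ℝ) < ((n : ℝ) + k + 1) ^ 2 := by positivity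
  have e1 : hypCoeff (n + 1) = ((n : ℝ) ^ 2 + n + 2 / 9) / ((n : ℝ) + 1) ^ 2 * hypCoeff n := by
    field_simp; linarith
  have e2 : hypCoeff (n + k + 1) =
      (((n : ℝ) + k) ^ 2 + (n + k) + 2 / 9) / ((n : ℝ) + k + 1) ^ 2 * hypCoeff (n + k) := by
    field_simp; linarith
  have key : ((n : ℝ) ^ 2 + n + 2 / 9) / ((n : ℝ) + 1) ^ 2 ≤
      (((n : ℝ) + k) ^ 2 + (n + k) + 2 / 9) / ((n : ℝ) + k + 1) ^ 2 := by
    rw [div_le_div_iff₀ p1 p2]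
    have : 0 ≤ (n : ℝ) * k := by positivity
    have : 0 ≤ (n : ℝ) ^ 2 * k := by positivity
    have : 0 ≤ (n : ℝ) * k ^ 2 := by positivity
    nlinarith
  rw [e1, e2]
  have := mul_le_mul_of_nonneg_right key (mul_pos (hypCoeff_pos n) (hypCoeff_pos (n + k))).le
  linarith

theorem harmCoeff_eq (n : ℕ) : harmCoeff n =
    3 * (∑ s ∈ range (3 * n + 1), (1 : ℝ) / s - ∑ s ∈ range (n + 1), (1 : ℝ) / s) := by
  rw [harmCoeff, ← sum_Ico_eq_sub _ (by omega)]
  rfl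

/-- The right side is the logarithmic derivative in n of the ratio (n^2 + n + 2/9)/(n+1)^2, as the
Frobenius method predicts for the logarithmic solution. -/
theorem harmCoeff_succ (n : ℕ) : harmCoeff (n + 1) - harmCoeff n =
    (2 * n + 1) / ((n : ℝ) ^ 2 + n + 2 / 9) - 2 / (n + 1) := by
  rw [harmCoeff_eq, harmCoeff_eq, show 3 * (n + 1) + 1 = 3 * n + 1 + 1 + 1 + 1 by ring]
  simp only [sum_range_succ]
  have hn : (0 : ℝ) ≤ n := n.cast_nonneg
  have e : (n : ℝ) ^ 2 + n + 2 / 9 = (n + 1 / 3) * (n + 2 / 3) := by ring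
  rw [e]
  have : (n : ℝ) + 1 / 3 ≠ 0 := by positivity
  have : (n : ℝ) + 2 / 3 ≠ 0 := by positivity
  push_cast
  field_simp
  ring

theorem harmCoeff_mono : Monotone harmCoeff := by
  refine monotone_nat_of_le_succ fun n => ?_
  rw [← sub_nonneg, harmCoeff_succ, sub_nonneg]
  have hn : (0 : ℝ) ≤ n := n.cast_nonneg
  rw [div_le_div_iff₀ (by positivity) (by positivity)]
  nlinarith

theorem sum_one_div_le_log (n m : ℕ) (hn : 1 ≤ n) (h : n ≤ m) :
    ∑ s ∈ Ioc n m, (1 : ℝ) / s ≤ Real.log m - Real.log n := by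
  induction m, h using Nat.le_induction with
  | base => simp
  | succ m hm ih =>
    rw [sum_Ioc_succ_top (by omega)]
    have hm0 : (0 : ℝ) < m := by exact_mod_cast (show 0 < m by omega)
    have : 1 / ((m + 1 : ℕ) : ℝ) ≤ Real.log ((m + 1 : ℕ) : ℝ) - Real.log m := by
      rw [← Real.log_div (by positivity) hm0.ne']
      have := Real.one_sub_inv_le_log_of_pos (x := ((m + 1 : ℕ) : ℝ) / m) (by positivity)
      refine le_trans (le_of_eq ?_) this
      push_cast
      field_simp
      ring
    linarith

/-- Comparison of H_{3n} - H_n with log 3n - log n = log 3. The constant is exactly what offsets the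
factor 1/27 in the nome. -/
theorem harmCoeff_le (n : ℕ) : harmCoeff n ≤ Real.log 27 := by
  rcases Nat.eq_zero_or_pos n with rfl | hn
  · rw [harmCoeff_zero]; positivity
  · have h := sum_one_div_le_log n (3 * n) hn (by omega)
    have h0 : (n : ℝ) ≠ 0 := by positivity
    rw [← Real.log_div (by positivity) h0] at h
    rw [show ((3 * n : ℕ) : ℝ) / n = 3 by push_cast; field_simp] at h
    have e : Real.log 27 = 3 * Real.log 3 := by
      rw [show (27 : ℝ) = 3 ^ 3 by norm_num, Real.log_pow]; norm_num
    rw [e]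
    refine mul_le_mul_of_nonneg_left (le_trans (le_of_eq ?_) h) (by norm_num)
    congr 1
    ext s
    simp only [mem_Icc, mem_Ioc]
    omega

theorem harmCoeff_nonneg (n : ℕ) : 0 ≤ harmCoeff n := by unfold harmCoeff; positivity

end LocalP2

namespace LocalP2

open Filter Topology Finset

/-! ### The hypergeometric function and its logarithmic companion -/

/-- The function `₂F₁(1/3, 2/3; 1; x)`. -/
noncomputable def hypF : ℂ → ℂ := psum fun n => (hypCoeff n : ℂ)

/-- The series `G` for which `F log x + G` is the second solution of the differential equation
of `F = hypF`. -/
noncomputable def hypG : ℂ → ℂ := psum fun n => ((hypCoeff n * harmCoeff n : ℝ) : ℂ)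

/-- The coefficients of `x (1 - x) F'`. -/
noncomputable def fluxCoeffF : ℕ → ℂ
  | 0 => 0
  | n + 1 => 2 / 9 * (hypCoeff n : ℂ) / (n + 1)

/-- The coefficients of `x (1 - x) G' + 2 (1 - x) F`. -/
noncomputable def fluxCoeffG : ℕ → ℂ
  | 0 => 2
  | n + 1 => (2 / 9 * ((hypCoeff n * harmCoeff n : ℝ) : ℂ) - (hypCoeff n : ℂ)) / (n + 1)

/-- The function `x (1 - x) F'`. -/
noncomputable def fluxF : ℂ → ℂ := psum fluxCoeffF

/-- The function `x (1 - x) G' + 2 (1 - x) F`. -/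
noncomputable def fluxG : ℂ → ℂ := psum fluxCoeffG

theorem norm_hypCoeff_le (n : ℕ) : ‖(hypCoeff n : ℂ)‖ ≤ 1 := by
  rw [Complex.norm_real, Real.norm_of_nonneg (hypCoeff_pos n).le]
  exact hypCoeff_le_one n

theorem norm_hypCoeff_mul_harmCoeff_le (n : ℕ) :
    ‖((hypCoeff n * harmCoeff n : ℝ) : ℂ)‖ ≤ Real.log 27 := by
  rw [Complex.norm_real, Real.norm_of_nonneg (mul_nonneg (hypCoeff_pos n).le (harmCoeff_nonneg n))]
  calc hypCoeff n * harmCoeff n ≤ 1 * Real.log 27 :=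
        mul_le_mul (hypCoeff_le_one n) (harmCoeff_le n) (harmCoeff_nonneg n) zero_le_one
    _ = Real.log 27 := one_mul _

theorem one_le_norm_natCast_add_one (n : ℕ) : 1 ≤ ‖(n : ℂ) + 1‖ := by
  have : ‖(n : ℂ) + 1‖ = n + 1 := by exact_mod_cast Complex.norm_natCast (n + 1)
  rw [this]
  linarith [n.cast_nonneg (α := ℝ)]

theorem norm_fluxCoeffF_le (n : ℕ) : ‖fluxCoeffF n‖ ≤ 1 := by
  cases n with
  | zero => simp [fluxCoeffF]
  | succ n =>
    rw [fluxCoeffF, norm_div, norm_mul]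
    refine div_le_one_of_le₀ ?_ (norm_nonneg _)
    have := norm_hypCoeff_le n
    have h29 : ‖(2 / 9 : ℂ)‖ = 2 / 9 := by norm_num
    rw [h29]
    linarith [one_le_norm_natCast_add_one n]

theorem norm_fluxCoeffG_le (n : ℕ) : ‖fluxCoeffG n‖ ≤ Real.log 27 + 2 := by
  have hl : 0 < Real.log 27 := Real.log_pos (by norm_num)
  cases n with
  | zero => simp [fluxCoeffG]; exact hl.le
  | succ n =>
    rw [fluxCoeffG, norm_div]
    refine (div_le_self (norm_nonneg _) (one_le_norm_natCast_add_one n)).trans ?_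
    refine (norm_sub_le _ _).trans ?_
    have := norm_hypCoeff_le n
    have h2 := norm_hypCoeff_mul_harmCoeff_le n
    have h29 : ‖(2 / 9 : ℂ)‖ = 2 / 9 := by norm_num
    rw [norm_mul, h29]
    linarith

variable {x : ℂ}

theorem hypF_zero : hypF 0 = 1 := by simp [hypF, psum_zero, hypCoeff_zero]

theorem hypG_zero : hypG 0 = 0 := by simp [hypG, psum_zero, harmCoeff_zero]

theorem fluxF_zero : fluxF 0 = 0 := by simp [fluxF, psum_zero, fluxCoeffF]

theorem fluxG_zero : fluxG 0 = 2 := by simp [fluxG, psum_zero, fluxCoeffG]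

theorem differentiableAt_hypF (hx : ‖x‖ < 1) : DifferentiableAt ℂ hypF x :=
  differentiableAt_psum norm_hypCoeff_le hx

theorem differentiableAt_hypG (hx : ‖x‖ < 1) : DifferentiableAt ℂ hypG x :=
  differentiableAt_psum norm_hypCoeff_mul_harmCoeff_le hx

/-- Together with `mul_deriv_hypF` this is the hypergeometric equation in self-adjoint form,
(x(1-x)F')' = (2/9)F. -/
theorem hasDerivAt_fluxF (hx : ‖x‖ < 1) : HasDerivAt fluxF (2 / 9 * hypF x) x := by
  have h := (differentiableAt_psum norm_fluxCoeffF_le hx).hasDerivAt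
  have h1 := (hasSum_psum norm_hypCoeff_le hx).mul_left (2 / 9)
  refine ((hasSum_deriv_psum norm_fluxCoeffF_le hx).unique
    (h1.congr_fun fun n => ?_)) ▸ h
  have : (n : ℂ) + 1 ≠ 0 := by exact_mod_cast n.succ_ne_zero
  rw [fluxCoeffF]
  field_simp

/-- With `mul_deriv_hypG`, this is the same equation for F log x + G with the logarithm removed. The
extra term 2(1-x)F in the flux makes the derivative free of F'. -/
theorem hasDerivAt_fluxG (hx : ‖x‖ < 1) :
    HasDerivAt fluxG (2 / 9 * hypG x - hypF x) x := by
  have h := (differentiableAt_psum norm_fluxCoeffG_le hx).hasDerivAt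
  have h1 := ((hasSum_psum norm_hypCoeff_mul_harmCoeff_le hx).mul_left (2 / 9)).sub
    (hasSum_psum norm_hypCoeff_le hx)
  refine ((hasSum_deriv_psum norm_fluxCoeffG_le hx).unique
    (h1.congr_fun fun n => ?_)) ▸ h
  have : (n : ℂ) + 1 ≠ 0 := by exact_mod_cast n.succ_ne_zero
  rw [fluxCoeffG]
  field_simp

theorem hasSum_mul_deriv_psum {c : ℕ → ℂ} {K : ℝ} (hc : ∀ n, ‖c n‖ ≤ K) (hx : ‖x‖ < 1) :
    HasSum (fun n : ℕ => (((n : ℂ) + 1) * c (n + 1) - n * c n) * x ^ (n + 1))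
      (x * (1 - x) * deriv (psum c) x) := by
  have h1 := (hasSum_deriv_psum hc hx).mul_left x
  have h2 : HasSum (fun n : ℕ => (n : ℂ) * c n * x ^ n) (x * deriv (psum c) x) := by
    rw [← hasSum_nat_add_iff' 1]
    simp only [range_one, sum_singleton, Nat.cast_zero, zero_mul, sub_zero]
    refine h1.congr_fun fun n => ?_
    push_cast
    ring
  have h3 := h1.sub (h2.mul_left x)
  rw [show x * (1 - x) * deriv (psum c) x =
    x * deriv (psum c) x - x * (x * deriv (psum c) x) by ring]
  refine h3.congr_fun fun n => ?_
  ring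

theorem hypCoeff_succ_complex (n : ℕ) : ((n : ℂ) + 1) ^ 2 * hypCoeff (n + 1) =
    ((n : ℂ) ^ 2 + n + 2 / 9) * hypCoeff n := by
  have h := congrArg (fun r : ℝ => (r : ℂ)) (hypCoeff_succ n)
  push_cast at h
  exact h

theorem mul_deriv_hypF (hx : ‖x‖ < 1) : x * (1 - x) * deriv hypF x = fluxF x := by
  refine (hasSum_mul_deriv_psum norm_hypCoeff_le hx).unique ?_
  have h := (hasSum_nat_add_iff' 1).2 (hasSum_psum norm_fluxCoeffF_le hx)
  simp only [range_one, sum_singleton, fluxCoeffF, zero_mul, sub_zero] at h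
  refine h.congr_fun fun n => ?_
  have h1 : (n : ℂ) + 1 ≠ 0 := by exact_mod_cast n.succ_ne_zero
  congr 1
  field_simp
  linear_combination 9 * hypCoeff_succ_complex n

theorem mul_deriv_hypG (hx : ‖x‖ < 1) :
    x * (1 - x) * deriv hypG x + 2 * (1 - x) * hypF x = fluxG x := by
  have hF := hasSum_psum norm_hypCoeff_le hx
  have h1 := ((hasSum_nat_add_iff' 1).2 hF).sub (hF.mul_left x)
  simp only [range_one, sum_singleton, hypCoeff_zero, Complex.ofReal_one, pow_zero, mul_one] at h1
  have h2 := (hasSum_mul_deriv_psum norm_hypCoeff_mul_harmCoeff_le hx).add (h1.mul_left 2)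
  have h3 := (hasSum_nat_add_iff' 1).2 (hasSum_psum norm_fluxCoeffG_le hx)
  simp only [range_one, sum_singleton, fluxCoeffG, pow_zero, mul_one] at h3
  have h4 := h2.unique (h3.congr_fun fun n => ?_)
  · change x * (1 - x) * deriv hypG x + 2 * (hypF x - 1 - x * hypF x) = fluxG x - 2 at h4
    linear_combination h4
  have h5 : (n : ℂ) + 1 ≠ 0 := by exact_mod_cast n.succ_ne_zero
  have h6 : harmCoeff (n + 1) = harmCoeff n +
    ((2 * n + 1) / ((n : ℝ) ^ 2 + n + 2 / 9) - 2 / (n + 1)) := by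
      linarith [harmCoeff_succ n]
  have h7 : ((n : ℝ) + 1) ^ 2 * (hypCoeff (n + 1) * harmCoeff (n + 1)) =
      ((n : ℝ) ^ 2 + n + 2 / 9) * (hypCoeff n * harmCoeff n) + (2 * n + 1) * hypCoeff n
        - 2 * (n + 1) * hypCoeff (n + 1) := by
    have e1 : (n : ℝ) ^ 2 + n + 2 / 9 ≠ 0 := by positivity
    rw [h6, ← mul_assoc, hypCoeff_succ]
    have e2 : (n : ℝ) + 1 ≠ 0 := by positivity
    have e3 : 2 * ((n : ℝ) + 1) * hypCoeff (n + 1) =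
        2 / (n + 1) * (((n : ℝ) ^ 2 + n + 2 / 9) * hypCoeff n) := by
      rw [← hypCoeff_succ]; field_simp
    rw [e3]
    field_simp
    ring
  have h8 : ((n : ℂ) + 1) ^ 2 * (hypCoeff (n + 1) * harmCoeff (n + 1)) =
      ((n : ℂ) ^ 2 + n + 2 / 9) * (hypCoeff n * harmCoeff n) + (2 * n + 1) * hypCoeff n
        - 2 * (n + 1) * hypCoeff (n + 1) := by
    have h := congrArg (fun r : ℝ => (r : ℂ)) h7
    push_cast at h
    exact h
  push_cast
  field_simp
  linear_combination (9 * x ^ (n + 1)) * h8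

/-- A holomorphic function on a disc about `0` whose derivative vanishes off `0` is constant. -/
theorem eq_value_zero_of_deriv_eq_zero {f : ℂ → ℂ} {r : ℝ}
    (hf : ∀ z, ‖z‖ < r → DifferentiableAt ℂ f z)
    (hd : ∀ z, ‖z‖ < r → z ≠ 0 → deriv f z = 0) {z : ℂ} (hz : ‖z‖ < r) : f z = f 0 := by
  have hr : 0 < r := (norm_nonneg z).trans_lt hz
  have hfo : DifferentiableOn ℂ f (Metric.ball 0 r) := fun w hw =>
    (hf w (mem_ball_zero_iff.1 hw)).differentiableWithinAt
  have h0 : (0 : ℂ) ∈ Metric.ball (0 : ℂ) r := Metric.mem_ball_self hr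
  have hcont : ContinuousAt (deriv f) 0 :=
    ((hfo.deriv Metric.isOpen_ball).differentiableAt (Metric.isOpen_ball.mem_nhds h0)).continuousAt
  have hlim : Tendsto (deriv f) (𝓝[≠] 0) (𝓝 0) := by
    refine tendsto_const_nhds.congr' ?_
    filter_upwards [self_mem_nhdsWithin, nhdsWithin_le_nhds (Metric.ball_mem_nhds (0 : ℂ) hr)]
      with w hw hw'
    exact (hd w (mem_ball_zero_iff.1 hw') hw).symm
  have hd0 : deriv f 0 = 0 :=
    tendsto_nhds_unique (hcont.tendsto.mono_left nhdsWithin_le_nhds) hlim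
  refine Metric.isOpen_ball.is_const_of_deriv_eq_zero (convex_ball 0 r).isPreconnected hfo
    (fun w hw => ?_) (mem_ball_zero_iff.2 hz) h0
  rcases eq_or_ne w 0 with rfl | hw0
  · exact hd0
  · exact hd w (mem_ball_zero_iff.1 hw) hw0

theorem one_sub_ne_zero_of_norm_lt_one (hx : ‖x‖ < 1) : 1 - x ≠ 0 := by
  intro h
  rw [← sub_eq_zero.1 h] at hx
  simp at hx

/-- The left side is x(1-x) times the Wronskian of F and F log x + G, constant by self-adjointness
and evaluated at 0. -/
theorem wronskian_hypF_hypG (hx : ‖x‖ < 1) :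
    hypF x * fluxG x - hypG x * fluxF x - (1 - x) * hypF x ^ 2 = 1 := by
  have key : ∀ z : ℂ, ‖z‖ < 1 → HasDerivAt
      (fun z => hypF z * fluxG z - hypG z * fluxF z - (1 - z) * hypF z ^ 2)
      (deriv hypF z * fluxG z + hypF z * (2 / 9 * hypG z - hypF z)
        - (deriv hypG z * fluxF z + hypG z * (2 / 9 * hypF z))
        - (-1 * hypF z ^ 2 + (1 - z) * (2 * hypF z * deriv hypF z))) z := by
    intro z hz
    have hF := (differentiableAt_hypF hz).hasDerivAt
    have hG := (differentiableAt_hypG hz).hasDerivAt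
    have h1 := (hasDerivAt_id z).const_sub 1
    have h2 := hF.pow 2
    refine (((hF.mul (hasDerivAt_fluxG hz)).sub (hG.mul (hasDerivAt_fluxF hz))).sub
      (h1.mul h2)).congr_deriv ?_
    simp
  have h := eq_value_zero_of_deriv_eq_zero (r := 1) (fun z hz => (key z hz).differentiableAt)
    (fun z hz _ => ?_) hx
  · rw [h, hypF_zero, fluxF_zero, fluxG_zero]; norm_num
  · rw [(key z hz).deriv]
    rw [← mul_deriv_hypF hz, ← mul_deriv_hypG hz]
    ring

end LocalP2

namespace LocalP2

open Filter Topology Finset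

/-! ### Nonvanishing of `F` and positivity of the coefficients of `G / F` -/

/-- The coefficients of the reciprocal of the power series with coefficients `a`, when `a 0 = 1`. -/
noncomputable def recipCoeff (a : ℕ → ℝ) (n : ℕ) : ℝ := PowerSeries.coeff n (PowerSeries.mk a)⁻¹

section Kaluza

variable {a g : ℕ → ℝ}

theorem recipCoeff_zero (h0 : a 0 = 1) : recipCoeff a 0 = 1 := by
  simp [recipCoeff, h0]

theorem sum_recipCoeff_mul (h0 : a 0 = 1) (n : ℕ) :
    ∑ k ∈ range (n + 1), recipCoeff a k * a (n - k) = if n = 0 then 1 else 0 := by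
  have h : (PowerSeries.mk a)⁻¹ * PowerSeries.mk a = 1 :=
    PowerSeries.inv_mul_cancel _ (by simp [h0])
  have h' := congrArg (PowerSeries.coeff n) h
  rw [PowerSeries.coeff_mul, Nat.sum_antidiagonal_eq_sum_range_succ_mk, PowerSeries.coeff_one] at h'
  simpa [recipCoeff] using h'

/-- Kaluza's theorem: the reciprocal of a power series with log-convex coefficients has
nonpositive coefficients in positive degrees. -/
theorem recipCoeff_nonpos (h0 : a 0 = 1) (hpos : ∀ n, 0 < a n)
    (hconv : ∀ n k, a (n + 1) * a (n + k) ≤ a n * a (n + k + 1)) {n : ℕ} (hn : n ≠ 0) :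
    recipCoeff a n ≤ 0 := by
  induction n using Nat.strong_induction_on with
  | _ n ih =>
    obtain ⟨m, rfl⟩ := Nat.exists_eq_succ_of_ne_zero hn
    have h1 := sum_recipCoeff_mul h0 (m + 1)
    rw [sum_range_succ, if_neg (by omega), Nat.sub_self, h0, mul_one] at h1
    rcases Nat.eq_zero_or_pos m with rfl | hm
    · simp only [zero_add, range_one, sum_singleton, recipCoeff_zero h0, one_mul, Nat.sub_zero]
        at h1
      have := hpos 1
      simp only [Nat.succ_eq_add_one, zero_add]
      linarith
    · have h2 := sum_recipCoeff_mul h0 m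
      rw [if_neg (by omega)] at h2
      -- The convolution relations in degrees m and m + 1 are cross-multiplied. The k = 0 terms
      -- agree; for k > 0 log-convexity is reversed by the nonpositive coefficient. The left sum is
      -- 0 and the right sum is minus the coefficient of degree m + 1.
      have h3 : (∑ k ∈ range (m + 1), recipCoeff a k * a (m - k)) * a (m + 1) ≤
          (∑ k ∈ range (m + 1), recipCoeff a k * a (m + 1 - k)) * a m := by
        rw [sum_mul, sum_mul]
        refine sum_le_sum fun k hk => ?_
        have hk' : k ≤ m := by simpa [Nat.lt_succ_iff] using hk
        rcases Nat.eq_zero_or_pos k with rfl | hk0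
        · simp only [Nat.sub_zero]; linarith
        · have h4 := hconv (m - k) k
          rw [Nat.sub_add_cancel hk', show m - k + 1 = m + 1 - k by omega] at h4
          have h5 := mul_le_mul_of_nonpos_left h4 (ih k (by omega) (by omega))
          linarith
      rw [h2, zero_mul] at h3
      have h4 := nonneg_of_mul_nonneg_left h3 (hpos m)
      rw [Nat.succ_eq_add_one]
      linarith

/-- In the relation of degree n > 0 the middle terms are nonpositive, so minus the nth coefficient
is at most `a n`. This makes 1/F converge on the whole unit disc. -/
theorem abs_recipCoeff_le (h0 : a 0 = 1) (hpos : ∀ n, 0 < a n)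
    (hconv : ∀ n k, a (n + 1) * a (n + k) ≤ a n * a (n + k + 1)) (n : ℕ) :
    |recipCoeff a n| ≤ a n := by
  rcases Nat.eq_zero_or_pos n with rfl | hn
  · simp [recipCoeff_zero h0, h0]
  · have hd := fun k (hk : k ≠ 0) => recipCoeff_nonpos h0 hpos hconv hk
    have h1 := sum_recipCoeff_mul h0 n
    obtain ⟨m, rfl⟩ := Nat.exists_eq_succ_of_ne_zero hn.ne'
    rw [if_neg (by omega), sum_range_succ, sum_range_succ', Nat.sub_self, h0,
      recipCoeff_zero h0, Nat.sub_zero] at h1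
    have h2 : ∑ k ∈ range m, recipCoeff a (k + 1) * a (m + 1 - (k + 1)) ≤ 0 :=
      sum_nonpos fun k _ => mul_nonpos_of_nonpos_of_nonneg (hd _ (by omega)) (hpos _).le
    rw [abs_of_nonpos (hd _ (by omega))]
    rw [Nat.succ_eq_add_one] at *
    linarith

/-- Subtracting `g n` times the vanishing convolution turns each term into a product of nonnegative
factors, by Kaluza's signs and monotonicity of `g`. -/
theorem sum_recipCoeff_mul_mul_nonneg (h0 : a 0 = 1) (hpos : ∀ n, 0 < a n)
    (hconv : ∀ n k, a (n + 1) * a (n + k) ≤ a n * a (n + k + 1)) (hg : Monotone g)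
    (hg0 : g 0 = 0) (n : ℕ) :
    0 ≤ ∑ k ∈ range (n + 1), recipCoeff a k * (a (n - k) * g (n - k)) := by
  rcases Nat.eq_zero_or_pos n with rfl | hn
  · simp [hg0]
  · have h1 := sum_recipCoeff_mul h0 n
    rw [if_neg hn.ne'] at h1
    have h2 : ∑ k ∈ range (n + 1), recipCoeff a k * (a (n - k) * g (n - k)) =
        ∑ k ∈ range (n + 1), -recipCoeff a k * (a (n - k) * (g n - g (n - k))) := by
      rw [← sub_eq_zero, ← sum_sub_distrib, ← zero_mul (g n), ← h1, sum_mul]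
      exact sum_congr rfl fun k _ => by ring
    rw [h2]
    refine sum_nonneg fun k _ => ?_
    rcases Nat.eq_zero_or_pos k with rfl | hk
    · simp
    · exact mul_nonneg (neg_nonneg.2 (recipCoeff_nonpos h0 hpos hconv hk.ne'))
        (mul_nonneg (hpos _).le (sub_nonneg.2 (hg (Nat.sub_le n k))))

end Kaluza

theorem tsum_mul_tsum_pow {𝕜 : Type*} [RCLike 𝕜] {c e : ℕ → 𝕜} {x : 𝕜}
    (hc : Summable fun n => ‖c n * x ^ n‖) (he : Summable fun n => ‖e n * x ^ n‖) :
    (∑' n, c n * x ^ n) * (∑' n, e n * x ^ n) =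
      ∑' n, (∑ k ∈ range (n + 1), c k * e (n - k)) * x ^ n ∧
    Summable fun n => ‖(∑ k ∈ range (n + 1), c k * e (n - k)) * x ^ n‖ := by
  have h : ∀ n, ∑ k ∈ range (n + 1), c k * x ^ k * (e (n - k) * x ^ (n - k)) =
      (∑ k ∈ range (n + 1), c k * e (n - k)) * x ^ n := by
    intro n
    rw [sum_mul]
    refine sum_congr rfl fun k hk => ?_
    rw [← Nat.add_sub_of_le (Nat.lt_succ_iff.1 (mem_range.1 hk)), pow_add, Nat.add_sub_cancel_left]
    ring
  constructor
  · rw [tsum_mul_tsum_eq_tsum_sum_range_of_summable_norm hc he]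
    exact tsum_congr h
  · refine (summable_norm_sum_mul_range_of_summable_norm hc he).congr fun n => ?_
    rw [h]

/-! ### The quotient G/F and the size of the nome. -/

variable {x : ℂ}

/-- The coefficients of `1 / F`. -/
noncomputable def invCoeff (n : ℕ) : ℝ := recipCoeff hypCoeff n

/-- The coefficients of `G / F`. -/
noncomputable def quotCoeff (n : ℕ) : ℝ :=
  ∑ k ∈ range (n + 1), invCoeff k * (hypCoeff (n - k) * harmCoeff (n - k))

theorem quotCoeff_nonneg (n : ℕ) : 0 ≤ quotCoeff n :=
  sum_recipCoeff_mul_mul_nonneg hypCoeff_zero hypCoeff_pos hypCoeff_logConvex harmCoeff_mono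
    harmCoeff_zero n

theorem abs_invCoeff_le_one (n : ℕ) : |invCoeff n| ≤ 1 :=
  (abs_recipCoeff_le hypCoeff_zero hypCoeff_pos hypCoeff_logConvex n).trans (hypCoeff_le_one n)

theorem norm_invCoeff_le (n : ℕ) : ‖(invCoeff n : ℂ)‖ ≤ 1 := by
  rw [Complex.norm_real]; exact abs_invCoeff_le_one n

theorem tsum_ite_eq_zero_pow {𝕜 : Type*} [RCLike 𝕜] (x : 𝕜) :
    ∑' n : ℕ, (if n = 0 then (1 : 𝕜) else 0) * x ^ n = 1 := by
  rw [tsum_eq_single 0]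
  · simp
  · intro n hn; simp [hn]

theorem psum_invCoeff_mul_hypF (hx : ‖x‖ < 1) : psum (fun n => (invCoeff n : ℂ)) x * hypF x = 1 := by
  have h := (tsum_mul_tsum_pow (summable_norm_of_bounded norm_invCoeff_le hx)
    (summable_norm_of_bounded norm_hypCoeff_le hx)).1
  refine h.trans ((tsum_congr fun n => ?_).trans (tsum_ite_eq_zero_pow x))
  congr 1
  have := congrArg (fun r : ℝ => (r : ℂ)) (sum_recipCoeff_mul hypCoeff_zero n)
  push_cast at this
  refine Eq.trans this ?_
  split_ifs <;> simp

theorem hypF_ne_zero (hx : ‖x‖ < 1) : hypF x ≠ 0 :=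
  right_ne_zero_of_mul (psum_invCoeff_mul_hypF hx ▸ one_ne_zero)

theorem hypG_div_hypF (hx : ‖x‖ < 1) :
    hypG x / hypF x = ∑' n, (quotCoeff n : ℂ) * x ^ n ∧
      Summable fun n => ‖(quotCoeff n : ℂ) * x ^ n‖ := by
  obtain ⟨h1, h2⟩ := tsum_mul_tsum_pow (summable_norm_of_bounded norm_invCoeff_le hx)
    (summable_norm_of_bounded norm_hypCoeff_mul_harmCoeff_le hx)
  have e : ∀ n, ∑ k ∈ range (n + 1),
      (invCoeff k : ℂ) * ((hypCoeff (n - k) * harmCoeff (n - k) : ℝ) : ℂ) = (quotCoeff n : ℂ) := by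
    intro n
    simp [quotCoeff]
  simp only [e] at h1 h2
  refine ⟨?_, h2⟩
  rw [← h1, div_eq_iff (hypF_ne_zero hx)]
  have := psum_invCoeff_mul_hypF hx
  simp only [hypG, psum] at *
  linear_combination -(∑' n, ((hypCoeff n * harmCoeff n : ℝ) : ℂ) * x ^ n) * this

/-- The sum is G(r)/F(r), and G ≤ (log 27) F holds coefficientwise. -/
theorem tsum_quotCoeff_le {r : ℝ} (hr0 : 0 ≤ r) (hr : r < 1) :
    ∑' n, quotCoeff n * r ^ n ≤ Real.log 27 := by
  have hgeo := summable_geometric_of_lt_one hr0 hr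
  have hs : ∀ (c : ℕ → ℝ) (K : ℝ), (∀ n, |c n| ≤ K) → Summable fun n => ‖c n * r ^ n‖ := by
    intro c K hc
    refine Summable.of_nonneg_of_le (fun _ => norm_nonneg _) (fun n => ?_) (hgeo.mul_left K)
    rw [norm_mul, norm_pow, Real.norm_of_nonneg hr0]
    exact mul_le_mul_of_nonneg_right (hc n) (by positivity)
  have s1 := hs invCoeff 1 abs_invCoeff_le_one
  have s2 := hs hypCoeff 1 fun n => by
    rw [abs_of_pos (hypCoeff_pos n)]; exact hypCoeff_le_one n
  have s3 := hs (fun n => hypCoeff n * harmCoeff n) (Real.log 27) fun n => by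
    have := norm_hypCoeff_mul_harmCoeff_le n
    rwa [Complex.norm_real] at this
  have h1 := (tsum_mul_tsum_pow s1 s2).1
  have h2 := (tsum_mul_tsum_pow s1 s3).1
  have h1' : (∑' n, invCoeff n * r ^ n) * (∑' n, hypCoeff n * r ^ n) = 1 := by
    rw [h1, ← tsum_ite_eq_zero_pow r]
    exact tsum_congr fun n => by rw [← sum_recipCoeff_mul hypCoeff_zero n]; rfl
  change _ = ∑' n, quotCoeff n * r ^ n at h2
  have hF : 0 < ∑' n, hypCoeff n * r ^ n := by
    refine lt_of_lt_of_le ?_ (s2.of_norm.le_tsum 0 fun n _ =>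
      mul_nonneg (hypCoeff_pos n).le (by positivity))
    simp [hypCoeff_zero]
  have hD : 0 < ∑' n, invCoeff n * r ^ n := pos_of_mul_pos_left (h1' ▸ one_pos) hF.le
  have hG : ∑' n, hypCoeff n * harmCoeff n * r ^ n ≤ Real.log 27 * ∑' n, hypCoeff n * r ^ n := by
    rw [← tsum_mul_left]
    refine s3.of_norm.tsum_le_tsum (fun n => ?_) (s2.of_norm.mul_left _)
    have : 0 ≤ hypCoeff n * r ^ n := mul_nonneg (hypCoeff_pos n).le (by positivity)
    nlinarith [harmCoeff_le n]
  rw [← h2]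
  calc _ ≤ (∑' n, invCoeff n * r ^ n) * (Real.log 27 * ∑' n, hypCoeff n * r ^ n) :=
        mul_le_mul_of_nonneg_left hG hD.le
    _ = Real.log 27 := by linear_combination Real.log 27 * h1'

/-- The modular coordinate as a function of the argument of `F`. -/
noncomputable def nomeFun (x : ℂ) : ℂ := x / 27 * Complex.exp (hypG x / hypF x)

/-- As G/F has nonnegative coefficients, its modulus at x is at most its value at |x|, hence at most
log 27. -/
theorem norm_nomeFun_le (hx : ‖x‖ < 1) : ‖nomeFun x‖ ≤ ‖x‖ := by
  obtain ⟨h1, h2⟩ := hypG_div_hypF hx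
  have h3 : ‖hypG x / hypF x‖ ≤ Real.log 27 := by
    rw [h1]
    refine (norm_tsum_le_tsum_norm h2).trans ?_
    refine le_trans (le_of_eq (tsum_congr fun n => ?_)) (tsum_quotCoeff_le (norm_nonneg x) hx)
    rw [norm_mul, norm_pow, Complex.norm_real, Real.norm_of_nonneg (quotCoeff_nonneg n)]
  rw [nomeFun, norm_mul, norm_div, Complex.norm_exp]
  have h4 : Real.exp (hypG x / hypF x).re ≤ 27 := by
    rw [← Real.exp_log (show (0 : ℝ) < 27 by norm_num)]
    exact Real.exp_le_exp.2 ((Complex.re_le_norm _).trans h3)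
  have h5 : ‖(27 : ℂ)‖ = 27 := by norm_num
  rw [h5]
  calc ‖x‖ / 27 * Real.exp (hypG x / hypF x).re ≤ ‖x‖ / 27 * 27 := by gcongr
    _ = ‖x‖ := by ring

theorem differentiableAt_nomeFun (hx : ‖x‖ < 1) : DifferentiableAt ℂ nomeFun x :=
  (differentiableAt_id.div_const 27).mul
    ((differentiableAt_hypG hx).div (differentiableAt_hypF hx) (hypF_ne_zero hx)).cexp

theorem nomeFun_ne_zero (hx : x ≠ 0) : nomeFun x ≠ 0 :=
  mul_ne_zero (div_ne_zero hx (by norm_num)) (Complex.exp_ne_zero _)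

end LocalP2

namespace LocalP2

open Filter Topology Finset

/-! ### The cubic transformation -/

/-- The cubic modulus `1 - ((1 - y) / (1 + 2 y))^3`. -/
noncomputable def cubicMod (y : ℂ) : ℂ := 9 * y * (1 + y + y ^ 2) / (1 + 2 * y) ^ 3

variable {x y : ℂ}

theorem one_add_two_mul_ne_zero (hy : ‖y‖ < 1 / 20) : 1 + 2 * y ≠ 0 := by
  intro h
  have h1 : (1 : ℂ) = -(2 * y) := by linear_combination h
  have h2 := congrArg norm h1
  rw [norm_one, norm_neg, norm_mul, Complex.norm_ofNat] at h2
  linarith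

/-- The radius 1/20 is only a convenient one; any neighbourhood of 0 would serve the later argument.
-/
theorem norm_cubicMod_lt_one (hy : ‖y‖ < 1 / 20) : ‖cubicMod y‖ < 1 := by
  have hy0 := norm_nonneg y
  have h1 : 9 / 10 ≤ ‖1 + 2 * y‖ := by
    have := norm_sub_norm_le (1 : ℂ) (-(2 * y))
    rw [norm_one, norm_neg, norm_mul, Complex.norm_ofNat, sub_neg_eq_add] at this
    linarith
  have h2 : ‖1 + y + y ^ 2‖ ≤ 11 / 10 := by
    refine (norm_add₃_le).trans ?_
    rw [norm_one, norm_pow]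
    nlinarith
  have h3 : (9 / 10 : ℝ) ^ 3 ≤ ‖1 + 2 * y‖ ^ 3 := pow_le_pow_left₀ (by norm_num) h1 3
  rw [cubicMod, norm_div, norm_mul, norm_mul, norm_pow, Complex.norm_ofNat,
    div_lt_one (by positivity)]
  calc 9 * ‖y‖ * ‖1 + y + y ^ 2‖ ≤ 9 * (1 / 20) * (11 / 10) := by gcongr
    _ < (9 / 10 : ℝ) ^ 3 := by norm_num
    _ ≤ _ := h3

theorem norm_pow_three_lt_one (hy : ‖y‖ < 1 / 20) : ‖y ^ 3‖ < 1 := by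
  rw [norm_pow]
  exact pow_lt_one₀ (norm_nonneg _) (by linarith) (by norm_num)

theorem cubicMod_zero : cubicMod 0 = 0 := by simp [cubicMod]

theorem one_sub_cubicMod (hy : 1 + 2 * y ≠ 0) : 1 - cubicMod y = (1 - y) ^ 3 / (1 + 2 * y) ^ 3 := by
  have h3 := pow_ne_zero 3 hy
  rw [cubicMod, eq_div_iff h3, sub_mul, div_mul_cancel₀ _ h3]
  ring

/-- The derivative of `cubicMod`. -/
noncomputable def cubicModDeriv (y : ℂ) : ℂ := 9 * (1 - y) ^ 2 / (1 + 2 * y) ^ 4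

theorem hasDerivAt_cubicMod (hy : 1 + 2 * y ≠ 0) : HasDerivAt cubicMod (cubicModDeriv y) y := by
  have hid := hasDerivAt_id y
  have h1 : HasDerivAt (fun y : ℂ => 9 * y * (1 + y + y ^ 2)) (9 + 18 * y + 27 * y ^ 2) y := by
    refine ((hid.const_mul 9).mul ((hid.const_add 1).add (hid.pow 2))).congr_deriv ?_
    simp
    ring
  have h2 : HasDerivAt (fun y : ℂ => (1 + 2 * y) ^ 3) (6 * (1 + 2 * y) ^ 2) y := by
    refine (((hid.const_mul 2).const_add 1).pow 3).congr_deriv ?_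
    simp
    ring
  refine (h1.div h2 (pow_ne_zero 3 hy)).congr_deriv ?_
  rw [cubicModDeriv]
  field_simp
  ring

theorem hasDerivAt_pow_three (y : ℂ) : HasDerivAt (fun y : ℂ => y ^ 3) (3 * y ^ 2) y := by
  simpa using hasDerivAt_pow 3 y

theorem cubicModDeriv_mul (hy : 1 + 2 * y ≠ 0) : cubicModDeriv y * (y * (1 - y ^ 3)) =
    cubicMod y * (1 - cubicMod y) * (1 + 2 * y) ^ 2 := by
  rw [one_sub_cubicMod hy, cubicMod, cubicModDeriv]
  field_simp
  ring

theorem hasDerivAt_comp_cubicMod {f : ℂ → ℂ} {f' : ℂ} (hy : ‖y‖ < 1 / 20)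
    (hf : HasDerivAt f f' (cubicMod y)) :
    HasDerivAt (fun y => f (cubicMod y)) (f' * cubicModDeriv y) y :=
  hf.comp y (hasDerivAt_cubicMod (one_add_two_mul_ne_zero hy))

theorem hasDerivAt_comp_pow_three {f : ℂ → ℂ} {f' : ℂ} (hf : HasDerivAt f f' (y ^ 3)) :
    HasDerivAt (fun y => f (y ^ 3)) (f' * (3 * y ^ 2)) y :=
  hf.comp y (hasDerivAt_pow_three y)

/-- For v = F(X(y)) and u = (1+2y)F(y^3), the left side is y(1-y^3)/(1+2y)^2 times v u' - u v'. Both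
satisfy one self-adjoint equation in y, so its derivative vanishes, and it is 0 at y = 0. -/
theorem wronskian_cubic (hy : ‖y‖ < 1 / 20) :
    hypF (cubicMod y) * (2 * y * (1 - y ^ 3) * hypF (y ^ 3) / (1 + 2 * y) ^ 2
      + 3 * fluxF (y ^ 3) / (1 + 2 * y))
      - (1 + 2 * y) * hypF (y ^ 3) * fluxF (cubicMod y) = 0 := by
  have key : ∀ z : ℂ, ‖z‖ < 1 / 20 → HasDerivAt (fun y : ℂ =>
      hypF (cubicMod y) * (2 * y * (1 - y ^ 3) * hypF (y ^ 3) / (1 + 2 * y) ^ 2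
      + 3 * fluxF (y ^ 3) / (1 + 2 * y))
      - (1 + 2 * y) * hypF (y ^ 3) * fluxF (cubicMod y)) 0 z := by
    intro z hz
    have hz1 := one_add_two_mul_ne_zero hz
    have hid := hasDerivAt_id z
    have hl : HasDerivAt (fun y : ℂ => 1 + 2 * y) 2 z :=
      ((hid.const_mul 2).const_add 1).congr_deriv (by simp)
    have hX := norm_cubicMod_lt_one hz
    have hz3 := norm_pow_three_lt_one hz
    have hFX := hasDerivAt_comp_cubicMod hz (differentiableAt_hypF hX).hasDerivAt
    have hPX := hasDerivAt_comp_cubicMod hz (hasDerivAt_fluxF hX)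
    have hF3 := hasDerivAt_comp_pow_three (differentiableAt_hypF hz3).hasDerivAt
    have hP3 := hasDerivAt_comp_pow_three (hasDerivAt_fluxF hz3)
    have h1 := ((((hid.const_mul 2).mul ((hasDerivAt_pow_three z).const_sub 1)).mul hF3).div
      (hl.pow 2) (pow_ne_zero 2 hz1)).add ((hP3.const_mul 3).div hl hz1)
    refine ((hFX.mul h1).sub ((hl.mul hF3).mul hPX)).congr_deriv ?_
    have e1 := mul_deriv_hypF hX
    have e2 := mul_deriv_hypF hz3
    have e3 := cubicModDeriv_mul hz1
    simp only [Pi.mul_apply, Pi.pow_apply, Pi.add_apply, Pi.div_apply, id]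
    have hz1' : 1 + z * 2 ≠ 0 := by rwa [mul_comm]
    generalize hypF (cubicMod z) = v at *
    generalize deriv hypF (cubicMod z) = v' at *
    generalize hypF (z ^ 3) = f at *
    generalize deriv hypF (z ^ 3) = f' at *
    rw [← e1, ← e2]
    have e4 : cubicMod z * (1 - cubicMod z) = cubicModDeriv z * (z * (1 - z ^ 3))
       / (1 + 2 * z) ^ 2 := by rw [e3]; field_simp
    rw [e4, cubicModDeriv]
    field_simp
    ring
  have h := eq_value_zero_of_deriv_eq_zero (r := 1 / 20) (fun z hz => (key z hz).differentiableAt)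
    (fun z hz _ => (key z hz).deriv) hy
  refine h.trans ?_
  simp [cubicMod_zero, fluxF_zero]

theorem hypF_cubicMod (hy : ‖y‖ < 1 / 20) :
    hypF (cubicMod y) = (1 + 2 * y) * hypF (y ^ 3) := by
  have key : ∀ z : ℂ, ‖z‖ < 1 / 20 → HasDerivAt (fun y : ℂ =>
      hypF (cubicMod y) / ((1 + 2 * y) * hypF (y ^ 3)))
      ((deriv hypF (cubicMod z) * cubicModDeriv z * ((1 + 2 * z) * hypF (z ^ 3)) -
        hypF (cubicMod z) * (2 * hypF (z ^ 3) + (1 + 2 * z) * (deriv hypF (z ^ 3) * (3 * z ^ 2))))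
        / ((1 + 2 * z) * hypF (z ^ 3)) ^ 2) z := by
    intro z hz
    have hl : HasDerivAt (fun y : ℂ => 1 + 2 * y) 2 z :=
      (((hasDerivAt_id z).const_mul 2).const_add 1).congr_deriv (by simp)
    exact (hasDerivAt_comp_cubicMod hz (differentiableAt_hypF
      (norm_cubicMod_lt_one hz)).hasDerivAt).div (hl.mul (hasDerivAt_comp_pow_three
      (differentiableAt_hypF (norm_pow_three_lt_one hz)).hasDerivAt))
      (mul_ne_zero (one_add_two_mul_ne_zero hz) (hypF_ne_zero (norm_pow_three_lt_one hz)))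
  have h := eq_value_zero_of_deriv_eq_zero (r := 1 / 20) (fun z hz => (key z hz).differentiableAt)
    (fun z hz hz0 => ?_) hy
  · rw [cubicMod_zero] at h
    rw [div_eq_iff (mul_ne_zero (one_add_two_mul_ne_zero hy)
      (hypF_ne_zero (norm_pow_three_lt_one hy)))] at h
    rw [h]
    simp [hypF_zero]
  · rw [(key z hz).deriv]
    have hz1 := one_add_two_mul_ne_zero hz
    have e0 := wronskian_cubic hz
    have e1 := mul_deriv_hypF (norm_cubicMod_lt_one hz)
    have e2 := mul_deriv_hypF (norm_pow_three_lt_one hz)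
    have e3 := cubicModDeriv_mul hz1
    have hz3 := one_sub_ne_zero_of_norm_lt_one (norm_pow_three_lt_one hz)
    refine div_eq_zero_iff.2 (Or.inl ?_)
    have h6 : z * (1 - z ^ 3) ≠ 0 := mul_ne_zero hz0 hz3
    refine (mul_eq_zero.1 (?_ : z * (1 - z ^ 3) * _ = 0)).resolve_left h6
    rw [← e1, ← e2] at e0
    field_simp at e0
    linear_combination (-1 : ℂ) * e0 +
      deriv hypF (cubicMod z) * ((1 + 2 * z) * hypF (z ^ 3)) * e3

/-- Equivalently, the logarithmic derivative of the nome is 1/(x(1-x)F^2), which is the Wronskian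
identity divided by F^2. -/
theorem mul_deriv_quot (hx : ‖x‖ < 1) : HasDerivAt (fun x => hypG x / hypF x)
    (deriv (fun x => hypG x / hypF x) x) x ∧
    x * (1 - x) * hypF x ^ 2 * deriv (fun x => hypG x / hypF x) x = 1 - (1 - x) * hypF x ^ 2 := by
  have hF0 := hypF_ne_zero hx
  have h := (differentiableAt_hypG hx).hasDerivAt.div (differentiableAt_hypF hx).hasDerivAt hF0
  refine ⟨h.differentiableAt.hasDerivAt, ?_⟩
  have e : deriv (fun x => hypG x / hypF x) x =
    (deriv hypG x * hypF x - hypG x * deriv hypF x) / hypF x ^ 2 := h.deriv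
  rw [e]
  have e0 := wronskian_hypF_hypG hx
  rw [← mul_deriv_hypF hx, ← mul_deriv_hypG hx] at e0
  field_simp
  linear_combination e0

theorem nomeFun_pow_three (hy : ‖y‖ < 1 / 20) : nomeFun (y ^ 3) = nomeFun (cubicMod y) ^ 3 := by
  set H : ℂ → ℂ := fun x => hypG x / hypF x with hH
  have hkd : ∀ z : ℂ, 1 + 2 * z ≠ 0 → HasDerivAt (fun y : ℂ => (1 + y + y ^ 2) / (1 + 2 * y) ^ 3)
      (((1 + 2 * z) ^ 2 - 6 * (1 + z + z ^ 2)) / (1 + 2 * z) ^ 4) z := by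
    intro z hz
    have hid := hasDerivAt_id z
    have h1 : HasDerivAt (fun y : ℂ => 1 + y + y ^ 2) (1 + 2 * z) z :=
      ((hid.const_add 1).add (hid.pow 2)).congr_deriv (by simp)
    have h2 : HasDerivAt (fun y : ℂ => (1 + 2 * y) ^ 3) (6 * (1 + 2 * z) ^ 2) z := by
      refine (((hid.const_mul 2).const_add 1).pow 3).congr_deriv ?_
      simp
      ring
    refine (h1.div h2 (pow_ne_zero 3 hz)).congr_deriv ?_
    field_simp
  -- This function is nomeFun(X(y))^3 / nomeFun(y^3) with the common factor y^3/27 cancelled, so it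
  -- is holomorphic at 0 with value 1.
  have key : ∀ z : ℂ, ‖z‖ < 1 / 20 → HasDerivAt (fun y : ℂ =>
      ((1 + y + y ^ 2) / (1 + 2 * y) ^ 3) ^ 3 * Complex.exp (3 * H (cubicMod y) - H (y ^ 3)))
      (3 * ((1 + z + z ^ 2) / (1 + 2 * z) ^ 3) ^ 2 *
        (((1 + 2 * z) ^ 2 - 6 * (1 + z + z ^ 2)) / (1 + 2 * z) ^ 4) *
        Complex.exp (3 * H (cubicMod z) - H (z ^ 3)) +
        ((1 + z + z ^ 2) / (1 + 2 * z) ^ 3) ^ 3 * (Complex.exp (3 * H (cubicMod z) - H (z ^ 3)) *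
        (3 * (deriv H (cubicMod z) * cubicModDeriv z) - deriv H (z ^ 3) * (3 * z ^ 2)))) z := by
    intro z hz
    have h1 := ((hasDerivAt_comp_cubicMod hz (mul_deriv_quot (norm_cubicMod_lt_one hz)).1).const_mul
      3).sub (hasDerivAt_comp_pow_three (mul_deriv_quot (norm_pow_three_lt_one hz)).1)
    refine (((hkd z (one_add_two_mul_ne_zero hz)).pow 3).mul h1.cexp).congr_deriv ?_
    simp [hH]
  have h := eq_value_zero_of_deriv_eq_zero (r := 1 / 20) (fun z hz => (key z hz).differentiableAt)
    (fun z hz hz0 => ?_) hy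
  · have h0 : H 0 = 0 := by simp [hH, hypG_zero]
    simp only [cubicMod_zero, ne_eq, OfNat.ofNat_ne_zero, not_false_eq_true, zero_pow, h0,
      mul_zero, sub_zero, add_zero, Complex.exp_zero, one_pow, div_one, mul_one] at h
    rw [Complex.exp_sub, show 3 * H (cubicMod y) = H (cubicMod y) + H (cubicMod y) + H (cubicMod y)
      by ring, Complex.exp_add, Complex.exp_add] at h
    have hne := Complex.exp_ne_zero (H (y ^ 3))
    change y ^ 3 / 27 * Complex.exp (H (y ^ 3)) =
      (cubicMod y / 27 * Complex.exp (H (cubicMod y))) ^ 3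
    rw [← mul_div_assoc, div_eq_iff hne] at h
    rw [cubicMod, ← one_mul (Complex.exp (H (y ^ 3))), ← h]
    rw [cubicMod]
    ring
  · rw [(key z hz).deriv]
    have hz1 := one_add_two_mul_ne_zero hz
    have e1 := (mul_deriv_quot (norm_cubicMod_lt_one hz)).2
    have e2 := (mul_deriv_quot (norm_pow_three_lt_one hz)).2
    have e3 := cubicModDeriv_mul hz1
    have hz3 := one_sub_ne_zero_of_norm_lt_one (norm_pow_three_lt_one hz)
    have hf := hypF_ne_zero (norm_pow_three_lt_one hz)
    rw [hypF_cubicMod hz] at e1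
    change _ * _ * _ * deriv H (cubicMod z) = _ at e1
    change _ * _ * _ * deriv H (z ^ 3) = _ at e2
    generalize Complex.exp (3 * H (cubicMod z) - H (z ^ 3)) = ε at *
    have e4 : deriv H (cubicMod z) * cubicModDeriv z * (z * (1 - z ^ 3)) * hypF (z ^ 3) ^ 2 =
        1 - (1 - cubicMod z) * ((1 + 2 * z) * hypF (z ^ 3)) ^ 2 := by
      rw [← e1]
      linear_combination (deriv H (cubicMod z) * hypF (z ^ 3) ^ 2) * e3
    rw [one_sub_cubicMod hz1] at e4
    have e5 : 3 * (deriv H (cubicMod z) * cubicModDeriv z) - deriv H (z ^ 3) * (3 * z ^ 2) =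
        3 * ((1 - (1 - z) ^ 3 / (1 + 2 * z) ^ 3 * ((1 + 2 * z) * hypF (z ^ 3)) ^ 2)
          - (1 - (1 - z ^ 3) * hypF (z ^ 3) ^ 2)) / (z * (1 - z ^ 3) * hypF (z ^ 3) ^ 2) := by
      rw [← e4, ← e2]
      field_simp
    have hz1' : 1 + z * 2 ≠ 0 := by rwa [mul_comm]
    rw [e5]
    field_simp
    ring

end LocalP2

namespace LocalP2

open Filter Topology Finset

/-! ### Euler's function and the triple product -/

/-- The finite product `∏_{k=1}^n (1 - q^k)`. -/
noncomputable def qPoch (q : ℂ) (n : ℕ) : ℂ := ∏ k ∈ range n, (1 - q ^ (k + 1))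

/-- Euler's function `∏_{k ≥ 1} (1 - q^k)`. -/
noncomputable def eulerFun (q : ℂ) : ℂ := ∏' k : ℕ, (1 - q ^ (k + 1))

/-- The triangular numbers. -/
def tri (j : ℕ) : ℕ := j * (j + 1) / 2

/-- The polynomials in `d` with `t₀ = 1`, `t₁ = d - 1`, `t_{j+2} = d t_{j+1} - t_j`. -/
noncomputable def chebSeq (d : ℂ) : ℕ → ℂ
  | 0 => 1
  | 1 => d - 1
  | j + 2 => d * chebSeq d (j + 1) - chebSeq d j

variable {q d : ℂ}

theorem qPoch_succ (q : ℂ) (n : ℕ) : qPoch q (n + 1) = qPoch q n * (1 - q ^ (n + 1)) :=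
  prod_range_succ _ _

theorem one_sub_pow_ne_zero (hq : ‖q‖ < 1) (n : ℕ) : 1 - q ^ (n + 1) ≠ 0 :=
  one_sub_ne_zero_of_norm_lt_one (by
    rw [norm_pow]; exact pow_lt_one₀ (norm_nonneg _) hq n.succ_ne_zero)

theorem qPoch_ne_zero (hq : ‖q‖ < 1) (n : ℕ) : qPoch q n ≠ 0 :=
  prod_ne_zero_iff.2 fun k _ => one_sub_pow_ne_zero hq k

theorem tendsto_qPoch (hq : ‖q‖ < 1) : Tendsto (qPoch q) atTop (𝓝 (eulerFun q)) :=
  (ModularForm.multipliable_one_sub_pow hq).tendsto_prod_tprod_nat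

theorem eulerFun_ne_zero (hq : ‖q‖ < 1) : eulerFun q ≠ 0 := by
  have h := tprod_one_add_ne_zero_of_summable (f := fun n : ℕ => -q ^ (n + 1))
    (fun n => by simpa [← sub_eq_add_neg] using one_sub_pow_ne_zero hq n)
    (by simpa using (summable_nat_add_iff 1).2 (summable_geometric_of_lt_one (norm_nonneg q) hq))
  simpa [eulerFun, ← sub_eq_add_neg] using h

theorem eulerFun_zero : eulerFun 0 = 1 := by simp [eulerFun]

theorem differentiableAt_eulerFun (hq : ‖q‖ < 1) : DifferentiableAt ℂ eulerFun q :=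
  ModularForm.differentiableOn_tprod_one_sub_pow.differentiableAt
    (Metric.isOpen_ball.mem_nhds (mem_ball_zero_iff.2 hq))

theorem tri_succ (j : ℕ) : tri (j + 1) = tri j + (j + 1) := by
  unfold tri
  rw [show (j + 1) * (j + 1 + 1) = j * (j + 1) + (j + 1) * 2 by ring,
    Nat.add_mul_div_right _ _ (by norm_num)]

theorem le_tri (j : ℕ) : j ≤ tri j := by
  cases j with
  | zero => exact Nat.zero_le _
  | succ j => rw [tri_succ]; omega

/-- The weight of `t_j` in the finite triple product. -/
noncomputable def tripleWeight (q : ℂ) (n j : ℕ) : ℂ :=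
  if j ≤ n then q ^ tri j * (qPoch q (2 * n + 1) / (qPoch q (n - j) * qPoch q (n + 1 + j))) else 0

theorem tripleWeight_eq (q : ℂ) (a j : ℕ) : tripleWeight q (a + j) j =
    q ^ tri j * (qPoch q (2 * a + 2 * j + 1) / (qPoch q a * qPoch q (a + 2 * j + 1))) := by
  rw [tripleWeight, if_pos (by omega), Nat.add_sub_cancel]
  congr 3
  · ring_nf
  · ring_nf

theorem tripleWeight_of_lt (q : ℂ) {n j : ℕ} (h : n < j) : tripleWeight q n j = 0 :=
  if_neg (by omega)

theorem tripleWeight_self (hq : ‖q‖ < 1) (n : ℕ) : tripleWeight q n n = q ^ tri n := by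
  have h := tripleWeight_eq q 0 n
  rw [zero_add] at h
  rw [h]
  have := qPoch_ne_zero hq (2 * n + 1)
  simp [qPoch] at this ⊢
  field_simp

/-- The weight is q^{j(j+1)/2} times the Gaussian binomial of 2n+1 over n-j. This recurrence and the
next are two q-Pascal steps, matching multiplication by 1 + d q^{n+1} + q^{2n+2}. -/
theorem tripleWeight_succ_zero (hq : ‖q‖ < 1) (n : ℕ) : tripleWeight q (n + 1) 0 =
    (1 + q ^ (2 * (n + 1))) * tripleWeight q n 0 +
      q ^ (n + 1) * (tripleWeight q n 0 + tripleWeight q n 1) := by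
  have h1 := tripleWeight_eq q (n + 1) 0
  have h2 := tripleWeight_eq q n 0
  have t0 : tri 0 = 0 := rfl
  have t1 : tri 1 = 1 := rfl
  simp only [add_zero, mul_zero, t0, pow_zero, one_mul] at h1 h2
  rw [h1, h2, show 2 * (n + 1) + 1 = 2 * n + 1 + 1 + 1 by ring, qPoch_succ q (2 * n + 1 + 1),
    qPoch_succ q (2 * n + 1), qPoch_succ q (n + 1)]
  have p1 := qPoch_ne_zero hq n
  have p2 := qPoch_ne_zero hq (n + 1)
  have p3 := one_sub_pow_ne_zero hq (n + 1)
  have p4 := one_sub_pow_ne_zero hq n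
  cases n with
  | zero =>
    rw [tripleWeight_of_lt q (by norm_num)]
    simp [qPoch, prod_range_succ] at *
    field_simp
    ring
  | succ m =>
    have h3 := tripleWeight_eq q m 1
    have p5 := qPoch_ne_zero hq m
    have p6 := one_sub_pow_ne_zero hq m
    rw [h3, t1, show 2 * m + 2 * 1 + 1 = 2 * (m + 1) + 1 by ring,
      show m + 2 * 1 + 1 = m + 1 + 1 + 1 by ring, qPoch_succ q (m + 1 + 1), qPoch_succ q (m + 1),
      qPoch_succ q m]
    rw [show q ^ (2 * (m + 1) + 1 + 1) = q ^ m * q ^ m * q ^ 4 by ring,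
      show q ^ (2 * (m + 1) + 1 + 1 + 1) = q ^ m * q ^ m * q ^ 5 by ring,
      show q ^ (2 * (m + 1 + 1)) = q ^ m * q ^ m * q ^ 4 by ring]
    rw [show q ^ (m + 1 + 1 + 1) = q ^ m * q ^ 3 by ring, show q ^ (m + 1 + 1) = q ^ m * q ^ 2 by ring,
      show q ^ (m + 1) = q ^ m * q by ring] at *
    generalize q ^ m = u at *
    field_simp
    ring

theorem tripleWeight_succ_succ (hq : ‖q‖ < 1) {n i : ℕ} (hi : i ≤ n) :
    tripleWeight q (n + 1) (i + 1) = (1 + q ^ (2 * (n + 1))) * tripleWeight q n (i + 1) +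
      q ^ (n + 1) * (tripleWeight q n i + tripleWeight q n (i + 2)) := by
  obtain ⟨a, rfl⟩ := Nat.exists_eq_add_of_le' hi
  have e0 := tri_succ i
  have e1 := tri_succ (i + 1)
  cases a with
  | zero =>
    rw [zero_add, tripleWeight_self hq, tripleWeight_self hq, tripleWeight_of_lt q (by omega),
      tripleWeight_of_lt q (by omega), e0]
    ring
  | succ a =>
    have h1 := tripleWeight_eq q (a + 1) (i + 1)
    have h2 := tripleWeight_eq q a (i + 1)
    have h3 := tripleWeight_eq q (a + 1) i
    rw [show a + (i + 1) = a + 1 + i by ring] at h2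
    rw [show a + 1 + (i + 1) = a + 1 + i + 1 by ring] at h1
    have p0 := qPoch_ne_zero hq a
    have p1 := qPoch_ne_zero hq (a + 2 * i + 2)
    have p2 := one_sub_pow_ne_zero hq a
    have p3 := one_sub_pow_ne_zero hq (a + 2 * i + 2)
    have p4 := one_sub_pow_ne_zero hq (a + 2 * i + 3)
    rw [h1, h2, h3, show 2 * (a + 1) + 2 * (i + 1) + 1 = 2 * a + 2 * i + 3 + 1 + 1 by ring,
      show 2 * a + 2 * (i + 1) + 1 = 2 * a + 2 * i + 3 by ring,
      show 2 * (a + 1) + 2 * i + 1 = 2 * a + 2 * i + 3 by ring,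
      show a + 1 + 2 * (i + 1) + 1 = a + 2 * i + 2 + 1 + 1 by ring,
      show a + 2 * (i + 1) + 1 = a + 2 * i + 2 + 1 by ring,
      show a + 1 + 2 * i + 1 = a + 2 * i + 2 by ring,
      qPoch_succ q (2 * a + 2 * i + 3 + 1), qPoch_succ q (2 * a + 2 * i + 3),
      qPoch_succ q (a + 2 * i + 2 + 1), qPoch_succ q (a + 2 * i + 2), qPoch_succ q a, e0]
    have r1 : q ^ (2 * a + 2 * i + 3 + 1) = (q ^ a) ^ 2 * (q ^ i) ^ 2 * q ^ 4 := by ring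
    have r2 : q ^ (2 * a + 2 * i + 3 + 1 + 1) = (q ^ a) ^ 2 * (q ^ i) ^ 2 * q ^ 5 := by ring
    have r3 : q ^ (2 * (a + 1 + i + 1)) = (q ^ a) ^ 2 * (q ^ i) ^ 2 * q ^ 4 := by ring
    have r4 : q ^ (a + 1 + i + 1) = q ^ a * q ^ i * q ^ 2 := by ring
    have r5 : q ^ (a + 1) = q ^ a * q := by ring
    have r6 : q ^ (a + 2 * i + 2 + 1) = q ^ a * (q ^ i) ^ 2 * q ^ 3 := by ring
    have r7 : q ^ (a + 2 * i + 3 + 1) = q ^ a * (q ^ i) ^ 2 * q ^ 4 := by ring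
    have r8 : q ^ (tri i + (i + 1)) = q ^ tri i * q ^ i * q := by ring
    have r9 : q ^ (a + 2 * i + 2 + 1 + 1) = q ^ a * (q ^ i) ^ 2 * q ^ 4 := by ring
    rw [r5] at p2
    rw [r6] at p3
    rw [r7] at p4
    rw [r1, r2, r3, r4, r5, r6, r8, r9]
    cases a with
    | zero =>
      rw [tripleWeight_of_lt q (by omega)]
      rw [pow_zero] at *
      generalize q ^ i = v at *
      generalize q ^ tri i = w at *
      -- The nonzero denominators become atoms while fractions are cleared and are restored for the
      -- polynomial check.
      generalize hB2 : 1 - 1 * q = B2 at *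
      generalize hB3 : 1 - 1 * v ^ 2 * q ^ 3 = B3 at *
      generalize hB4 : 1 - 1 * v ^ 2 * q ^ 4 = B4 at *
      field_simp
      subst hB2 hB3 hB4
      ring
    | succ b =>
      have h4 := tripleWeight_eq q b (i + 2)
      rw [show b + (i + 2) = b + 1 + 1 + i by ring] at h4
      have p5 := qPoch_ne_zero hq b
      have p6 := one_sub_pow_ne_zero hq b
      rw [h4, show 2 * b + 2 * (i + 2) + 1 = 2 * (b + 1) + 2 * i + 3 by ring,
        show b + 2 * (i + 2) + 1 = (b + 1) + 2 * i + 2 + 1 + 1 by ring,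
        qPoch_succ q (b + 1 + 2 * i + 2 + 1), qPoch_succ q (b + 1 + 2 * i + 2), qPoch_succ q b,
        r9, r6, e1, e0]
      have s1 : q ^ (tri i + (i + 1) + (i + 1 + 1)) = q ^ tri i * (q ^ i) ^ 2 * q ^ 3 := by ring
      rw [s1]
      rw [show q ^ (b + 1) = q ^ b * q by ring] at *
      generalize q ^ i = v at *
      generalize q ^ tri i = w at *
      generalize q ^ b = u at *
      generalize qPoch q (b + 1 + 2 * i + 2) = A at *
      generalize hB2 : 1 - u * q * q = B2 at *
      generalize hB3 : 1 - u * q * v ^ 2 * q ^ 3 = B3 at *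
      generalize hB4 : 1 - u * q * v ^ 2 * q ^ 4 = B4 at *
      generalize hB6 : 1 - u * q = B6 at *
      field_simp
      subst hB2 hB3 hB4 hB6
      ring

/-- Summation by parts for d t_j = t_{j+1} + t_{j-1}; the boundary rule at 0 comes from d t_0 = t_1
+ t_0. -/
theorem sum_chebSeq_mul (d : ℂ) (f g : ℕ → ℂ) (N : ℕ) (h0 : g 0 = f 0 + f 1)
    (hg : ∀ j, g (j + 1) = f j + f (j + 2)) :
    ∑ j ∈ range (N + 1), chebSeq d j * g j = d * ∑ j ∈ range (N + 1), chebSeq d j * f j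
      + chebSeq d N * f (N + 1) - chebSeq d (N + 1) * f N := by
  induction N with
  | zero => simp [chebSeq, h0]; ring
  | succ N ih =>
    rw [sum_range_succ, ih, sum_range_succ _ (N + 1), hg, chebSeq]
    ring

theorem finite_triple_product (hq : ‖q‖ < 1) (d : ℂ) (n : ℕ) :
    ∏ k ∈ range n, (1 + d * q ^ (k + 1) + q ^ (2 * (k + 1))) =
      ∑ j ∈ range (n + 1), chebSeq d j * tripleWeight q n j := by
  induction n with
  | zero =>
    have := tripleWeight_self hq 0
    simp [chebSeq, this, tri]
  | succ n ih =>
    have h := sum_chebSeq_mul d (tripleWeight q n) (fun j => match j with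
      | 0 => tripleWeight q n 0 + tripleWeight q n 1
      | j + 1 => tripleWeight q n j + tripleWeight q n (j + 2)) (n + 1) rfl (fun _ => rfl)
    rw [tripleWeight_of_lt q (show n < n + 1 + 1 by omega),
      tripleWeight_of_lt q (show n < n + 1 by omega), mul_zero, mul_zero, add_zero, sub_zero] at h
    have hs : ∑ j ∈ range (n + 1 + 1), chebSeq d j * tripleWeight q n j =
        ∑ j ∈ range (n + 1), chebSeq d j * tripleWeight q n j := by
      rw [sum_range_succ, tripleWeight_of_lt q (show n < n + 1 by omega), mul_zero, add_zero]
    rw [prod_range_succ, ih]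
    rw [hs] at h
    have e : ∑ j ∈ range (n + 1 + 1), chebSeq d j * tripleWeight q (n + 1) j =
        ∑ j ∈ range (n + 1 + 1), ((1 + q ^ (2 * (n + 1))) * (chebSeq d j * tripleWeight q n j) +
          q ^ (n + 1) * (chebSeq d j * (match j with
            | 0 => tripleWeight q n 0 + tripleWeight q n 1
            | j + 1 => tripleWeight q n j + tripleWeight q n (j + 2)))) := by
      refine sum_congr rfl fun j hj => ?_
      cases j with
      | zero => rw [tripleWeight_succ_zero hq]; ring
      | succ i =>
        rw [tripleWeight_succ_succ hq (by rw [mem_range] at hj; omega)]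
        ring
    rw [e, sum_add_distrib, ← mul_sum, ← mul_sum, h, hs]
    ring

theorem exists_norm_qPoch_bounds (hq : ‖q‖ < 1) :
    ∃ C : ℝ, 0 ≤ C ∧ ∀ n, ‖qPoch q n‖ ≤ C ∧ ‖(qPoch q n)⁻¹‖ ≤ C := by
  have h1 := Metric.isBounded_range_of_tendsto _ (tendsto_qPoch hq)
  have h2 := Metric.isBounded_range_of_tendsto _ ((tendsto_qPoch hq).inv₀ (eulerFun_ne_zero hq))
  obtain ⟨C1, hC1⟩ := h1.exists_norm_le
  obtain ⟨C2, hC2⟩ := h2.exists_norm_le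
  have hC1' := fun n => hC1 _ (Set.mem_range_self n)
  have hC2' := fun n => hC2 _ (Set.mem_range_self n)
  exact ⟨max C1 C2, ((norm_nonneg _).trans (hC1' 0)).trans (le_max_left _ _), fun n =>
    ⟨(hC1' n).trans (le_max_left _ _), (hC2' n).trans (le_max_right _ _)⟩⟩

theorem summable_mul_pow_tri {r : ℝ} (hr0 : 0 ≤ r) (hr : r < 1) :
    Summable fun j : ℕ => (2 * (j : ℝ) + 2) * r ^ tri j := by
  have h1 := summable_pow_mul_geometric_of_norm_lt_one 1 (r := r)
    (by rwa [Real.norm_of_nonneg hr0])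
  have h2 := summable_geometric_of_lt_one hr0 hr
  refine Summable.of_nonneg_of_le (fun j => by positivity) (fun j => ?_)
    ((h1.mul_left 2).add (h2.mul_left 2))
  have := mul_le_mul_of_nonneg_left (pow_le_pow_of_le_one hr0 hr.le (le_tri j))
    (by positivity : (0 : ℝ) ≤ 2 * (j : ℝ) + 2)
  refine this.trans (le_of_eq ?_)
  ring

/-- Jacobi's triple product identity, folded about its centre, with `d = -(z + 1/z)`. -/
theorem triple_product (hq : ‖q‖ < 1) (hd : ∀ j : ℕ, ‖chebSeq d j‖ ≤ 2 * j + 2) {L : ℂ}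
    (hL : Tendsto (fun n => ∏ k ∈ range n, (1 + d * q ^ (k + 1) + q ^ (2 * (k + 1)))) atTop (𝓝 L)) :
    ∑' j, chebSeq d j * q ^ tri j = eulerFun q * L := by
  have hE := eulerFun_ne_zero hq
  obtain ⟨C, hC0, hC⟩ := exists_norm_qPoch_bounds hq
  have hP := tendsto_qPoch hq
  have hlim : Tendsto (fun n => ∑' j, chebSeq d j * tripleWeight q n j) atTop
      (𝓝 (∑' j, chebSeq d j * (q ^ tri j * (eulerFun q / (eulerFun q * eulerFun q))))) := by
    -- Each Gaussian binomial tends to 1/E(q), and the uniform bounds on the finite products and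
    -- their inverses give the dominating series.
    refine tendsto_tsum_of_dominated_convergence
      (bound := fun j : ℕ => C ^ 3 * ((2 * (j : ℝ) + 2) * ‖q‖ ^ tri j))
      ((summable_mul_pow_tri (norm_nonneg q) hq).mul_left _) (fun j => ?_)
      (Eventually.of_forall fun n j => ?_)
    · refine Tendsto.const_mul _ ?_
      have h1 : Tendsto (fun n => qPoch q (2 * n + 1)) atTop (𝓝 (eulerFun q)) :=
        hP.comp (tendsto_atTop_mono (fun n => by simp only [id]; omega) tendsto_id)
      have h2 : Tendsto (fun n => qPoch q (n - j)) atTop (𝓝 (eulerFun q)) :=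
        hP.comp (tendsto_sub_atTop_nat j)
      have h3 : Tendsto (fun n => qPoch q (n + 1 + j)) atTop (𝓝 (eulerFun q)) :=
        hP.comp (tendsto_atTop_mono (fun n => by simp only [id]; omega) tendsto_id)
      refine ((h1.div (h2.mul h3) (mul_ne_zero hE hE)).const_mul (q ^ tri j)).congr' ?_
      filter_upwards [eventually_ge_atTop j] with n hn
      rw [tripleWeight, if_pos hn]
      rfl
    · rw [norm_mul]
      have hw : ‖tripleWeight q n j‖ ≤ ‖q‖ ^ tri j * C ^ 3 := by
        rw [tripleWeight]
        split_ifs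
        · rw [div_eq_mul_inv, mul_inv, norm_mul, norm_mul, norm_mul, norm_pow,
            show C ^ 3 = C * (C * C) by ring]
          gcongr
          · exact (hC _).1
          · exact (hC _).2
          · exact (hC _).2
        · rw [norm_zero]; positivity
      calc _ ≤ (2 * (j : ℝ) + 2) * (‖q‖ ^ tri j * C ^ 3) :=
            mul_le_mul (hd j) hw (norm_nonneg _) (by positivity)
        _ = _ := by ring
  have hfin : ∀ n, ∑' j, chebSeq d j * tripleWeight q n j =
      ∏ k ∈ range n, (1 + d * q ^ (k + 1) + q ^ (2 * (k + 1))) := by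
    intro n
    rw [finite_triple_product hq, tsum_eq_sum]
    intro j hj
    rw [tripleWeight_of_lt q (by rw [mem_range] at hj; omega), mul_zero]
  simp only [hfin] at hlim
  rw [tendsto_nhds_unique hL hlim, ← tsum_mul_left]
  refine tsum_congr fun j => ?_
  field_simp

/-! ### The triple product at z = 1 and at a primitive cube root of unity. -/

theorem chebSeq_neg_two (j : ℕ) : chebSeq (-2) j = (-1) ^ j * (2 * j + 1) := by
  induction j using Nat.twoStepInduction with
  | zero => simp [chebSeq]
  | one => simp [chebSeq]; norm_num
  | more j h1 h2 => rw [chebSeq, h1, h2]; push_cast; ring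

/-- Jacobi's identity for the cube of Euler's function. -/
theorem eulerFun_pow_three (hq : ‖q‖ < 1) :
    eulerFun q ^ 3 = ∑' j : ℕ, (-1) ^ j * (2 * (j : ℂ) + 1) * q ^ tri j := by
  have h := triple_product (d := -2) (L := eulerFun q ^ 2) hq (fun j => ?_) ?_
  · simp only [chebSeq_neg_two] at h
    rw [h]
    ring
  · rw [chebSeq_neg_two, norm_mul, norm_pow, norm_neg, norm_one, one_pow, one_mul]
    refine (norm_add_le _ _).trans ?_
    simp
  · refine ((tendsto_qPoch hq).pow 2).congr fun n => ?_
    rw [qPoch, ← prod_pow]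
    exact prod_congr rfl fun k _ => by ring

theorem chebSeq_one (j : ℕ) : (Real.sqrt 3 / 2 : ℂ) * chebSeq 1 j =
    Complex.cos ((2 * j + 1) * (Real.pi / 6)) := by
  have c6 : Complex.cos (Real.pi / 6) = Real.sqrt 3 / 2 := by
    have := congrArg (fun r : ℝ => (r : ℂ)) Real.cos_pi_div_six
    push_cast at this
    exact this
  have c3 : Complex.cos (Real.pi / 3) = 1 / 2 := by
    have := congrArg (fun r : ℝ => (r : ℂ)) Real.cos_pi_div_three
    push_cast at this
    exact this
  induction j using Nat.twoStepInduction with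
  | zero => simp [chebSeq, c6]
  | one =>
    simp only [chebSeq, Nat.cast_one]
    rw [show (2 * 1 + 1 : ℂ) * (Real.pi / 6) = Real.pi / 2 by ring, Complex.cos_pi_div_two]
    ring
  | more j h1 h2 =>
    rw [chebSeq, one_mul, mul_sub, h1, h2]
    have e1 := Complex.cos_add ((2 * ((j + 1 : ℕ) : ℂ) + 1) * (Real.pi / 6)) (Real.pi / 3)
    have e2 := Complex.cos_sub ((2 * ((j + 1 : ℕ) : ℂ) + 1) * (Real.pi / 6)) (Real.pi / 3)
    have a1 : (2 * ((j + 2 : ℕ) : ℂ) + 1) * (Real.pi / 6) =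
        (2 * ((j + 1 : ℕ) : ℂ) + 1) * (Real.pi / 6) + Real.pi / 3 := by push_cast; ring
    have a2 : (2 * (j : ℂ) + 1) * (Real.pi / 6) =
        (2 * ((j + 1 : ℕ) : ℂ) + 1) * (Real.pi / 6) - Real.pi / 3 := by push_cast; ring
    rw [a1, a2, e1, e2, c3]
    ring

theorem norm_chebSeq_one_le (j : ℕ) : ‖chebSeq 1 j‖ ≤ 2 := by
  have h := congrArg norm (chebSeq_one j)
  have h1 : ((2 * (j : ℂ) + 1) * (Real.pi / 6)) =
      (((2 * (j : ℝ) + 1) * (Real.pi / 6) : ℝ) : ℂ) := by push_cast; ring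
  rw [h1, ← Complex.ofReal_cos, Complex.norm_real, norm_mul, norm_div, Complex.norm_real,
    Complex.norm_ofNat, Real.norm_of_nonneg (Real.sqrt_nonneg 3)] at h
  have h2 : ‖Real.cos ((2 * (j : ℝ) + 1) * (Real.pi / 6))‖ ≤ 1 := Real.abs_cos_le_one _
  have h3 : 1 ≤ Real.sqrt 3 := by rw [Real.one_le_sqrt]; norm_num
  nlinarith [norm_nonneg (chebSeq 1 j)]

/-- For d = 1 the factor 1 + q^k + q^{2k} is (1 - q^{3k})/(1 - q^k). By `chebSeq_one` the series is
that of θ₂ at π/6, up to √3 and a power of the nome. -/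
theorem eulerFun_cube_eq_tsum (hq : ‖q‖ < 1) :
    eulerFun (q ^ 3) = ∑' j : ℕ, chebSeq 1 j * q ^ tri j := by
  have hq3 : ‖q ^ 3‖ < 1 := by
    rw [norm_pow]; exact pow_lt_one₀ (norm_nonneg _) hq (by norm_num)
  have hE := eulerFun_ne_zero hq
  have h := triple_product (d := 1) (L := eulerFun (q ^ 3) / eulerFun q) hq (fun j => ?_) ?_
  · rw [h, mul_div_cancel₀ _ hE]
  · have := norm_chebSeq_one_le j
    have hj : (0 : ℝ) ≤ j := j.cast_nonneg
    linarith
  · refine ((tendsto_qPoch hq3).div (tendsto_qPoch hq) hE).congr fun n => ?_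
    rw [Pi.div_apply, div_eq_iff (qPoch_ne_zero hq n), qPoch, qPoch, ← prod_mul_distrib]
    exact prod_congr rfl fun k _ => by ring

end LocalP2

namespace LocalP2

open Filter Topology Finset

/-! ### Cubic relations for Euler's function -/

variable {q w : ℂ}

theorem exists_primitive_cube_root : ∃ w : ℂ, w ^ 2 + w + 1 = 0 := by
  have h : ((Real.sqrt 3 : ℝ) : ℂ) ^ 2 = 3 := by
    rw [← Complex.ofReal_pow, Real.sq_sqrt (by norm_num)]; norm_num
  refine ⟨(-1 + Real.sqrt 3 * Complex.I) / 2, ?_⟩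
  linear_combination (1 / 4 : ℂ) * Complex.I ^ 2 * h + (3 / 4 : ℂ) * Complex.I_sq

theorem pow_three_eq_one (hw : w ^ 2 + w + 1 = 0) : w ^ 3 = 1 := by
  linear_combination (w - 1) * hw

theorem norm_eq_one_of_cube_root (hw : w ^ 2 + w + 1 = 0) : ‖w‖ = 1 := by
  have h := congrArg norm (pow_three_eq_one hw)
  rw [norm_pow, norm_one] at h
  exact (pow_eq_one_iff_of_nonneg (norm_nonneg w) (by norm_num)).1 h

theorem norm_pow_lt_one (hq : ‖q‖ < 1) {n : ℕ} (hn : n ≠ 0) : ‖q ^ n‖ < 1 := by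
  rw [norm_pow]; exact pow_lt_one₀ (norm_nonneg _) hq hn

/-- The three rotations of 1 - q^k multiply to 1 - q^{3k} when 3 does not divide k, and to (1 -
q^k)^3 when it does. Three consecutive values of k are treated at each step. -/
theorem qPoch_mul_rotations (hw : w ^ 2 + w + 1 = 0) (q : ℂ) (n : ℕ) :
    qPoch q (3 * n) * qPoch (w * q) (3 * n) * qPoch (w ^ 2 * q) (3 * n) * qPoch (q ^ 9) n =
      qPoch (q ^ 3) (3 * n) * qPoch (q ^ 3) n ^ 3 := by
  have hw3 := pow_three_eq_one hw
  induction n with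
  | zero => simp [qPoch]
  | succ n ih =>
    have e : ∀ z : ℂ, qPoch z (3 * (n + 1)) = qPoch z (3 * n) * ((1 - (z ^ 3) ^ n * z) *
        (1 - (z ^ 3) ^ n * z ^ 2) * (1 - (z ^ 3) ^ n * z ^ 3)) := by
      intro z
      rw [show 3 * (n + 1) = 3 * n + 1 + 1 + 1 by ring, qPoch_succ, qPoch_succ, qPoch_succ]
      ring
    have c1 : (w * q) ^ 3 = q ^ 3 := by linear_combination q ^ 3 * hw3
    have c2 : (w ^ 2 * q) ^ 3 = q ^ 3 := by linear_combination q ^ 3 * (w ^ 3 + 1) * hw3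
    have e9 : qPoch (q ^ 9) (n + 1) = qPoch (q ^ 9) n * (1 - ((q ^ 3) ^ n * q ^ 3) ^ 3) := by
      rw [qPoch_succ]; ring
    have e3 : qPoch (q ^ 3) (n + 1) = qPoch (q ^ 3) n * (1 - (q ^ 3) ^ n * q ^ 3) := by
      rw [qPoch_succ]; ring
    have k : ∀ u : ℂ, (1 - u) * (1 - w * u) * (1 - w ^ 2 * u) = 1 - u ^ 3 := by
      intro u
      linear_combination (-u + w * u ^ 2 - (w - 1) * u ^ 3) * hw
    have k1 := k ((q ^ 3) ^ n * q)
    have k2 := k ((q ^ 3) ^ n * q ^ 2)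
    have hw4 : w ^ 4 = w := by linear_combination w * hw3
    rw [e q, e (w * q), e (w ^ 2 * q), e (q ^ 3), c1, c2, e9, e3]
    have f3 : ((q ^ 3) ^ 3) ^ n = ((q ^ 3) ^ n) ^ 3 := by ring
    rw [f3]
    generalize (q ^ 3) ^ n = u at *
    have g1 : 1 - u * (w * q) ^ 2 = 1 - w ^ 2 * (u * q ^ 2) := by ring
    have g2 : 1 - u * (w ^ 2 * q) ^ 2 = 1 - w * (u * q ^ 2) := by
      linear_combination (-u * q ^ 2) * hw4
    have g3 : 1 - u * (w * q) = 1 - w * (u * q) := by ring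
    have g4 : 1 - u * (w ^ 2 * q) = 1 - w ^ 2 * (u * q) := by ring
    rw [g1, g2, g3, g4]
    calc _ = (qPoch q (3 * n) * qPoch (w * q) (3 * n) * qPoch (w ^ 2 * q) (3 * n) *
          qPoch (q ^ 9) n) * ((1 - u * q) * (1 - w * (u * q)) * (1 - w ^ 2 * (u * q))) *
          ((1 - u * q ^ 2) * (1 - w * (u * q ^ 2)) * (1 - w ^ 2 * (u * q ^ 2))) *
          ((1 - u * q ^ 3) ^ 3 * (1 - (u * q ^ 3) ^ 3)) := by ring
      _ = _ := by rw [ih, k1, k2]; ring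

theorem eulerFun_mul_rotations (hw : w ^ 2 + w + 1 = 0) (hq : ‖q‖ < 1) :
    eulerFun q * eulerFun (w * q) * eulerFun (w ^ 2 * q) * eulerFun (q ^ 9) =
      eulerFun (q ^ 3) ^ 4 := by
  have hw1 := norm_eq_one_of_cube_root hw
  have h1 : ‖w * q‖ < 1 := by rwa [norm_mul, hw1, one_mul]
  have h2 : ‖w ^ 2 * q‖ < 1 := by rwa [norm_mul, norm_pow, hw1, one_pow, one_mul]
  have h3 := norm_pow_lt_one hq (n := 3) (by norm_num)
  have h9 := norm_pow_lt_one hq (n := 9) (by norm_num)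
  have ht : Tendsto (fun n : ℕ => 3 * n) atTop atTop :=
    tendsto_atTop_mono (fun n => by simp only [id]; omega) tendsto_id
  have l := ((((tendsto_qPoch hq).comp ht).mul ((tendsto_qPoch h1).comp ht)).mul
    ((tendsto_qPoch h2).comp ht)).mul (tendsto_qPoch h9)
  have r := ((tendsto_qPoch h3).comp ht).mul ((tendsto_qPoch h3).pow 3)
  refine (tendsto_nhds_unique l (r.congr fun n => ?_)).trans (by ring)
  exact (qPoch_mul_rotations hw q n).symm

/-- The part of `E(q)^3` with exponents divisible by `3`. -/
noncomputable def cubePart (q : ℂ) : ℂ := eulerFun q ^ 3 + 3 * q * eulerFun (q ^ 9) ^ 3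

theorem two_mul_tri (j : ℕ) : 2 * tri j = j * (j + 1) :=
  Nat.mul_div_cancel' (Nat.even_mul_succ_self j).two_dvd

theorem tri_mod_three {j : ℕ} (h : j % 3 ≠ 1) : 3 ∣ tri j := by
  have h2 := two_mul_tri j
  have h3 : 3 ∣ j * (j + 1) := by
    have : j % 3 = 0 ∨ j % 3 = 2 := by omega
    rcases this with h | h
    · exact Dvd.dvd.mul_right (Nat.dvd_of_mod_eq_zero h) _
    · exact Dvd.dvd.mul_left (Nat.dvd_of_mod_eq_zero (by omega)) _
  omega

theorem tri_three_mul_add_one (k : ℕ) : tri (3 * k + 1) = 9 * tri k + 1 := by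
  have h1 := two_mul_tri (3 * k + 1)
  have h2 := two_mul_tri k
  nlinarith

theorem summable_eulerFun_pow_three (hq : ‖q‖ < 1) :
    Summable fun j : ℕ => (-1) ^ j * (2 * (j : ℂ) + 1) * q ^ tri j := by
  refine .of_norm_bounded (summable_mul_pow_tri (norm_nonneg q) hq) fun j => ?_
  rw [norm_mul, norm_mul, norm_pow, norm_pow, norm_neg, norm_one, one_pow, one_mul]
  gcongr
  refine (norm_add_le _ _).trans ?_
  simp

/-- In Jacobi's series for E^3 the exponents are divisible by 3 except at j = 3k+1, where those
terms sum to -3q E(q^9)^3. The rest is invariant under q ↦ wq. -/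
theorem cubePart_rotate (hw : w ^ 2 + w + 1 = 0) (hq : ‖q‖ < 1) :
    cubePart (w * q) = cubePart q := by
  have hw1 := norm_eq_one_of_cube_root hw
  have hw3 := pow_three_eq_one hw
  have h1 : ‖w * q‖ < 1 := by rwa [norm_mul, hw1, one_mul]
  have h9 := norm_pow_lt_one hq (n := 9) (by norm_num)
  have e9 : (w * q) ^ 9 = q ^ 9 := by linear_combination q ^ 9 * (w ^ 6 + w ^ 3 + 1) * hw3
  have key : eulerFun (w * q) ^ 3 - eulerFun q ^ 3 = -((w - 1) * (3 * q)) * eulerFun (q ^ 9) ^ 3 := by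
    rw [eulerFun_pow_three h1, eulerFun_pow_three hq, eulerFun_pow_three h9,
      ← (summable_eulerFun_pow_three h1).tsum_sub (summable_eulerFun_pow_three hq),
      ← tsum_mul_left]
    have hinj : Function.Injective fun k : ℕ => 3 * k + 1 := fun a b h => by
      simp only at h; omega
    rw [← hinj.tsum_eq]
    · refine tsum_congr fun k => ?_
      rw [tri_three_mul_add_one]
      have s1 : (-1 : ℂ) ^ (3 * k + 1) = -(-1) ^ k := by
        rw [pow_succ, pow_mul]; norm_num
      have s2 : (w * q) ^ (9 * tri k + 1) = w * (q * (q ^ 9) ^ tri k) := by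
        rw [pow_succ, pow_mul, e9]; ring
      have s3 : q ^ (9 * tri k + 1) = q * (q ^ 9) ^ tri k := by
        rw [pow_succ, pow_mul]; ring
      rw [s1, s2, s3]
      push_cast
      ring
    · intro j hj
      by_contra hne
      refine hj ?_
      have h3 : j % 3 ≠ 1 := by
        intro h
        exact hne ⟨j / 3, by simp only; omega⟩
      obtain ⟨m, hm⟩ := tri_mod_three h3
      beta_reduce
      rw [hm, mul_pow, pow_mul w, hw3, one_pow, one_mul, sub_self]
  rw [cubePart, cubePart, e9]
  linear_combination key

/-- With T = `cubePart q` and s = 3q E(q^9)^3, the rotated cubes are T - s, T - ws and T - w^2 s.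
Their product T^3 - s^3 enters the cube of `eulerFun_mul_rotations`. -/
theorem eulerFun_cube_relation (hq : ‖q‖ < 1) : eulerFun (q ^ 3) ^ 12 =
    eulerFun (q ^ 9) ^ 3 * (cubePart q ^ 3 - (3 * q * eulerFun (q ^ 9) ^ 3) ^ 3) := by
  obtain ⟨w, hw⟩ := exists_primitive_cube_root
  have hw3 := pow_three_eq_one hw
  have hw1 := norm_eq_one_of_cube_root hw
  have h1 : ‖w * q‖ < 1 := by rwa [norm_mul, hw1, one_mul]
  have r0 : eulerFun q ^ 3 = cubePart q - 3 * q * eulerFun (q ^ 9) ^ 3 := by rw [cubePart]; ring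
  have r1 : eulerFun (w * q) ^ 3 = cubePart q - w * (3 * q * eulerFun (q ^ 9) ^ 3) := by
    rw [← cubePart_rotate hw hq, cubePart, show (w * q) ^ 9 = q ^ 9 by
      linear_combination q ^ 9 * (w ^ 6 + w ^ 3 + 1) * hw3]
    ring
  have r2 : eulerFun (w ^ 2 * q) ^ 3 = cubePart q - w ^ 2 * (3 * q * eulerFun (q ^ 9) ^ 3) := by
    rw [← cubePart_rotate hw hq, ← cubePart_rotate hw h1, ← mul_assoc, ← pow_two, cubePart,
      show (w ^ 2 * q) ^ 9 = q ^ 9 by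
      linear_combination q ^ 9 * (w ^ 9 + 1) * (w ^ 6 + w ^ 3 + 1) * hw3]
    ring
  have h := congrArg (· ^ 3) (eulerFun_mul_rotations hw hq)
  simp only [mul_pow] at h
  rw [r0, r1, r2] at h
  rw [show eulerFun (q ^ 3) ^ 12 = (eulerFun (q ^ 3) ^ 4) ^ 3 by ring, ← h]
  generalize cubePart q = T
  generalize eulerFun (q ^ 9) ^ 3 = e
  linear_combination e * (-T ^ 2 * (3 * q * e) + T * (3 * q * e) ^ 2 * w
    - (3 * q * e) ^ 3 * (w - 1)) * hw

/-! ### The cubic modulus as a function of the nome -/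

/-- The cube of the Borwein function `a(q)`. -/
noncomputable def borweinCube (q : ℂ) : ℂ :=
  eulerFun q ^ 9 / eulerFun (q ^ 3) ^ 3 + 27 * q * eulerFun (q ^ 3) ^ 9 / eulerFun q ^ 3

/-- The cubic modulus `c(q)^3 / a(q)^3`. -/
noncomputable def nomeMod (q : ℂ) : ℂ :=
  27 * q * eulerFun (q ^ 3) ^ 9 / (eulerFun q ^ 3 * borweinCube q)

/-- The ratio `c(q^3) / a(q^3)`. -/
noncomputable def cubicRatio (q : ℂ) : ℂ := 3 * q * eulerFun (q ^ 9) ^ 3 / cubePart q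

theorem borweinCube_cube (hq : ‖q‖ < 1) :
    borweinCube (q ^ 3) = cubePart q ^ 3 / eulerFun (q ^ 3) ^ 3 := by
  have h3 := eulerFun_ne_zero (norm_pow_lt_one hq (n := 3) (by norm_num))
  have h9 := eulerFun_ne_zero (norm_pow_lt_one hq (n := 9) (by norm_num))
  have h := eulerFun_cube_relation hq
  rw [borweinCube, ← pow_mul]
  norm_num
  field_simp
  linear_combination h

theorem borweinCube_eq (hq : ‖q‖ < 1) :
    borweinCube q = (cubePart q + 2 * (3 * q * eulerFun (q ^ 9) ^ 3)) ^ 3 /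
      eulerFun (q ^ 3) ^ 3 := by
  have h1 := eulerFun_ne_zero hq
  have h3 := eulerFun_ne_zero (norm_pow_lt_one hq (n := 3) (by norm_num))
  have h := eulerFun_cube_relation hq
  have e : cubePart q = eulerFun q ^ 3 + 3 * q * eulerFun (q ^ 9) ^ 3 := rfl
  rw [borweinCube]
  rw [e] at h ⊢
  field_simp
  linear_combination 27 * q * h

/-- The cube of Borwein's relation a(q) = a(q^3) + 2c(q^3). -/
theorem borweinCube_eq_mul (hq : ‖q‖ < 1) (hT : cubePart q ≠ 0) :
    borweinCube q = (1 + 2 * cubicRatio q) ^ 3 * borweinCube (q ^ 3) := by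
  rw [borweinCube_cube hq, borweinCube_eq hq, cubicRatio]
  field_simp

theorem nomeMod_cube (hq : ‖q‖ < 1) (hT : cubePart q ≠ 0) :
    nomeMod (q ^ 3) = cubicRatio q ^ 3 := by
  have h3 := eulerFun_ne_zero (norm_pow_lt_one hq (n := 3) (by norm_num))
  rw [nomeMod, borweinCube_cube hq, ← pow_mul, cubicRatio]
  norm_num
  field_simp
  ring

theorem nomeMod_eq (hq : ‖q‖ < 1) (hT : cubePart q ≠ 0) (hy : 1 + 2 * cubicRatio q ≠ 0) :
    nomeMod q = cubicMod (cubicRatio q) := by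
  have h1 := eulerFun_ne_zero hq
  have h3 := eulerFun_ne_zero (norm_pow_lt_one hq (n := 3) (by norm_num))
  have h := eulerFun_cube_relation hq
  have hT2 : cubePart q + 2 * (3 * q * eulerFun (q ^ 9) ^ 3) ≠ 0 := by
    intro h0
    refine hy ?_
    rw [cubicRatio]
    field_simp
    linear_combination h0
  have e1 : cubicMod (cubicRatio q) = 9 * (3 * q * eulerFun (q ^ 9) ^ 3) *
      (cubePart q ^ 2 + cubePart q * (3 * q * eulerFun (q ^ 9) ^ 3) +
      (3 * q * eulerFun (q ^ 9) ^ 3) ^ 2) /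
      (cubePart q + 2 * (3 * q * eulerFun (q ^ 9) ^ 3)) ^ 3 := by
    have e2 : 1 + 2 * cubicRatio q =
      (cubePart q + 2 * (3 * q * eulerFun (q ^ 9) ^ 3)) / cubePart q := by
        rw [cubicRatio]; field_simp
    rw [cubicMod, e2, cubicRatio]
    generalize 3 * q * eulerFun (q ^ 9) ^ 3 = c at *
    generalize hs : cubePart q + 2 * c = s at *
    field_simp
  rw [e1, nomeMod, borweinCube_eq hq]
  have e : eulerFun q ^ 3 = cubePart q - 3 * q * eulerFun (q ^ 9) ^ 3 := by rw [cubePart]; ring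
  have h1' := pow_ne_zero 3 h1
  rw [e] at h1' ⊢
  generalize hs : cubePart q + 2 * (3 * q * eulerFun (q ^ 9) ^ 3) = s at *
  generalize hc : cubePart q - 3 * q * eulerFun (q ^ 9) ^ 3 = r at *
  field_simp
  rw [← hc]
  linear_combination 27 * q * h

end LocalP2

namespace LocalP2

open Filter Topology Finset

/-! ### The modular parametrization -/

variable {q : ℂ}

/-- Iterating bounds |f(q)| by |f(q^{3^n})|, which tends to |f(0)| = 0. -/
theorem eq_zero_of_norm_le_norm_cube {f : ℂ → ℂ} {r : ℝ} (hr : r ≤ 1) (hf : ContinuousAt f 0)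
    (h0 : f 0 = 0) (hle : ∀ q, ‖q‖ < r → ‖f q‖ ≤ ‖f (q ^ 3)‖) (hq : ‖q‖ < r) : f q = 0 := by
  have hq1 : ‖q‖ < 1 := hq.trans_le hr
  have h : ∀ n : ℕ, ‖f q‖ ≤ ‖f (q ^ 3 ^ n)‖ := by
    intro n
    induction n with
    | zero => simp
    | succ n ih =>
      refine ih.trans ?_
      rw [pow_succ, pow_mul]
      refine hle _ (lt_of_le_of_lt ?_ hq)
      rw [norm_pow]
      exact pow_le_of_le_one (norm_nonneg q) hq1.le (by positivity)
  have ht : Tendsto (fun n : ℕ => q ^ 3 ^ n) atTop (𝓝 0) :=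
    (tendsto_pow_atTop_nhds_zero_of_norm_lt_one hq1).comp
      (tendsto_pow_atTop_atTop_of_one_lt (by norm_num))
  have hl := (hf.tendsto.comp ht).norm
  rw [h0, norm_zero] at hl
  exact norm_le_zero_iff.1 (ge_of_tendsto' hl h)

theorem continuousAt_eulerFun_pow (hq : ‖q‖ < 1) {n : ℕ} (hn : n ≠ 0) :
    ContinuousAt (fun q => eulerFun (q ^ n)) q :=
  ContinuousAt.comp (f := fun q : ℂ => q ^ n)
    (differentiableAt_eulerFun (norm_pow_lt_one hq hn)).continuousAt (continuous_pow n).continuousAt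

theorem norm_zero_lt_one : ‖(0 : ℂ)‖ < 1 := by simp

theorem continuousAt_cubePart : ContinuousAt cubePart 0 :=
  ((differentiableAt_eulerFun norm_zero_lt_one).continuousAt.pow 3).add
    ((continuousAt_id.const_mul 3).mul ((continuousAt_eulerFun_pow norm_zero_lt_one
      (by norm_num)).pow 3))

theorem cubePart_zero : cubePart 0 = 1 := by simp [cubePart, eulerFun_zero]

theorem continuousAt_cubicRatio : ContinuousAt cubicRatio 0 :=
  ((continuousAt_id.const_mul 3).mul ((continuousAt_eulerFun_pow norm_zero_lt_one
    (by norm_num)).pow 3)).div continuousAt_cubePart (by rw [cubePart_zero]; exact one_ne_zero)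

theorem cubicRatio_zero : cubicRatio 0 = 0 := by simp [cubicRatio]

theorem continuousAt_borweinCube : ContinuousAt borweinCube 0 := by
  have h1 := (differentiableAt_eulerFun norm_zero_lt_one).continuousAt
  have h3 := continuousAt_eulerFun_pow norm_zero_lt_one (n := 3) (by norm_num)
  refine ((h1.pow 9).div (h3.pow 3) ?_).add (((continuousAt_id.const_mul 27).mul
    (h3.pow 9)).div (h1.pow 3) ?_)
  · simp [eulerFun_zero]
  · simp [eulerFun_zero]

theorem borweinCube_zero : borweinCube 0 = 1 := by simp [borweinCube, eulerFun_zero]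

/-- The function `c(q)^3 / (27 q a(q)^3)`. -/
noncomputable def nomeModUnit (q : ℂ) : ℂ :=
  eulerFun (q ^ 3) ^ 9 / (eulerFun q ^ 3 * borweinCube q)

theorem nomeMod_eq_mul (q : ℂ) : nomeMod q = 27 * q * nomeModUnit q := by
  rw [nomeMod, nomeModUnit, mul_div_assoc]

theorem nomeModUnit_zero : nomeModUnit 0 = 1 := by
  simp [nomeModUnit, eulerFun_zero, borweinCube_zero]

theorem continuousAt_nomeModUnit : ContinuousAt nomeModUnit 0 := by
  have h1 := (differentiableAt_eulerFun norm_zero_lt_one).continuousAt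
  have h3 := continuousAt_eulerFun_pow norm_zero_lt_one (n := 3) (by norm_num)
  refine (h3.pow 9).div ((h1.pow 3).mul continuousAt_borweinCube) ?_
  simp [eulerFun_zero, borweinCube_zero]

theorem nomeMod_zero : nomeMod 0 = 0 := by simp [nomeMod]

theorem continuousAt_nomeMod : ContinuousAt nomeMod 0 := by
  have h : nomeMod = fun q => 27 * q * nomeModUnit q := funext nomeMod_eq_mul
  rw [h]
  exact (continuousAt_id.const_mul 27).mul continuousAt_nomeModUnit

theorem continuousAt_comp_nomeMod {f : ℂ → ℂ} (hf : DifferentiableAt ℂ f 0) :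
    ContinuousAt (fun q => f (nomeMod q)) 0 :=
  ContinuousAt.comp (by rw [nomeMod_zero]; exact hf.continuousAt) continuousAt_nomeMod

/-- The ratio of the two sides of `nomeFun (nomeMod q) = q`. -/
noncomputable def nomeRatio (q : ℂ) : ℂ :=
  nomeModUnit q * Complex.exp (hypG (nomeMod q) / hypF (nomeMod q))

theorem nomeFun_nomeMod (q : ℂ) : nomeFun (nomeMod q) = q * nomeRatio q := by
  rw [nomeFun, nomeRatio]
  nth_rewrite 1 [nomeMod_eq_mul]
  ring

theorem nomeRatio_zero : nomeRatio 0 = 1 := by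
  simp [nomeRatio, nomeModUnit_zero, nomeMod_zero, hypG_zero]

theorem continuousAt_nomeRatio : ContinuousAt nomeRatio 0 := by
  refine continuousAt_nomeModUnit.mul (continuousAt_comp_nomeMod
    (f := fun x => Complex.exp (hypG x / hypF x)) ?_)
  exact ((differentiableAt_hypG norm_zero_lt_one).div (differentiableAt_hypF norm_zero_lt_one)
    (hypF_ne_zero norm_zero_lt_one)).cexp

theorem exists_radius_near_zero : ∃ r : ℝ, 0 < r ∧ r ≤ 1 ∧ ∀ q : ℂ, ‖q‖ < r →
    cubePart q ≠ 0 ∧ ‖cubicRatio q‖ < 1 / 20 ∧ borweinCube q ≠ 0 ∧ ‖nomeRatio q - 1‖ < 1 / 4 := by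
  have h1 : ∀ᶠ q in 𝓝 (0 : ℂ), cubePart q ≠ 0 :=
    continuousAt_cubePart.eventually_ne (by rw [cubePart_zero]; exact one_ne_zero)
  have h2 : ∀ᶠ q in 𝓝 (0 : ℂ), ‖cubicRatio q‖ < 1 / 20 :=
    continuousAt_cubicRatio.norm.eventually_lt_const (by simp [cubicRatio_zero])
  have h3 : ∀ᶠ q in 𝓝 (0 : ℂ), borweinCube q ≠ 0 :=
    continuousAt_borweinCube.eventually_ne (by rw [borweinCube_zero]; exact one_ne_zero)
  have h4 : ∀ᶠ q in 𝓝 (0 : ℂ), ‖nomeRatio q - 1‖ < 1 / 4 :=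
    (continuousAt_nomeRatio.sub_const 1).norm.eventually_lt_const (by simp [nomeRatio_zero])
  obtain ⟨r, hr, h⟩ := Metric.eventually_nhds_iff.1 (h1.and (h2.and (h3.and h4)))
  exact ⟨min r 1, lt_min hr one_pos, min_le_right _ _, fun q hq =>
    h (by rw [dist_zero_right]; exact hq.trans_le (min_le_left _ _))⟩

/-- The ratio F^3/a^3 takes the same value at q and q^3, while the nome ratio u satisfies u(q^3) =
u(q)^3; both equal 1 at 0. -/
theorem hypF_nomeMod : ∀ᶠ q in 𝓝 (0 : ℂ), borweinCube q ≠ 0 ∧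
    hypF (nomeMod q) ^ 3 = borweinCube q ∧ nomeFun (nomeMod q) = q := by
  obtain ⟨r, hr, hr1, h⟩ := exists_radius_near_zero
  have hcube : ∀ q : ℂ, ‖q‖ < r → ‖q ^ 3‖ < r := fun q hq => by
    rw [norm_pow]
    exact (pow_le_of_le_one (norm_nonneg q) (hq.trans_le hr1).le (by norm_num)).trans_lt hq
  filter_upwards [Metric.ball_mem_nhds (0 : ℂ) hr] with q hq
  rw [mem_ball_zero_iff] at hq
  refine ⟨(h q hq).2.2.1, ?_, ?_⟩
  · have hF := eq_zero_of_norm_le_norm_cube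
      (f := fun q => hypF (nomeMod q) ^ 3 / borweinCube q - 1) hr1
      (((((continuousAt_comp_nomeMod (differentiableAt_hypF norm_zero_lt_one)).pow 3).div
        continuousAt_borweinCube (by rw [borweinCube_zero]; exact one_ne_zero))).sub
        continuousAt_const)
      (by simp [nomeMod_zero, hypF_zero, borweinCube_zero]) (fun z hz => ?_) hq
    · exact (div_eq_one_iff_eq (h q hq).2.2.1).1 (sub_eq_zero.1 hF)
    · obtain ⟨hT, hy, hN, -⟩ := h z hz
      have hz1 := hz.trans_le hr1
      have hN3 := (h _ (hcube z hz)).2.2.1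
      have hy1 := one_add_two_mul_ne_zero hy
      refine le_of_eq ?_
      congr 2
      rw [nomeMod_eq hz1 hT hy1, nomeMod_cube hz1 hT, hypF_cubicMod hy, borweinCube_eq_mul hz1 hT]
      rw [mul_pow]
      exact mul_div_mul_left _ _ (pow_ne_zero 3 hy1)
  · have hu := eq_zero_of_norm_le_norm_cube (f := fun q => nomeRatio q - 1) hr1
      (continuousAt_nomeRatio.sub_const 1) (by simp [nomeRatio_zero]) (fun z hz => ?_) hq
    · rw [nomeFun_nomeMod, sub_eq_zero.1 hu, mul_one]
    · obtain ⟨hT, hy, -, h4⟩ := h z hz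
      have hz1 := hz.trans_le hr1
      rcases eq_or_ne z 0 with rfl | hz0
      · simp
      have e : nomeRatio (z ^ 3) = nomeRatio z ^ 3 := by
        have e1 := nomeFun_pow_three hy
        rw [← nomeMod_eq hz1 hT (one_add_two_mul_ne_zero hy), ← nomeMod_cube hz1 hT,
          nomeFun_nomeMod, nomeFun_nomeMod, mul_pow] at e1
        exact mul_left_cancel₀ (pow_ne_zero 3 hz0) e1
      -- This is u^3 - 1 = (u - 1)(3 + 3(u - 1) + (u - 1)^2). For |u - 1| < 1/4 the second factor
      -- has modulus above 3 - 3/4 - 1/16 > 1, so cubing does not bring u closer to 1.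
      have e2 : nomeRatio (z ^ 3) - 1 = (nomeRatio z - 1) *
          (3 - (-(3 * (nomeRatio z - 1)) - (nomeRatio z - 1) ^ 2)) := by rw [e]; ring
      rw [e2, norm_mul]
      have e3 := norm_sub_norm_le (3 : ℂ) (-(3 * (nomeRatio z - 1)) - (nomeRatio z - 1) ^ 2)
      have e4 := norm_sub_le (-(3 * (nomeRatio z - 1))) ((nomeRatio z - 1) ^ 2)
      rw [norm_neg, norm_mul, norm_pow, Complex.norm_ofNat] at e4
      rw [Complex.norm_ofNat] at e3
      have hn := norm_nonneg (nomeRatio z - 1)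
      nlinarith

/-- The discriminant identity: `x (1 - x) F(x)^6 = 27 𝔮 E(𝔮)^6 E(𝔮^3)^6` with `𝔮 = nomeFun x`. -/
theorem mul_hypF_pow_six {x : ℂ} (hx : ‖x‖ < 1) : x * (1 - x) * hypF x ^ 6 =
    27 * nomeFun x * eulerFun (nomeFun x) ^ 6 * eulerFun (nomeFun x ^ 3) ^ 6 := by
  have hball : ∀ {z : ℂ}, z ∈ Metric.ball (0 : ℂ) 1 → ‖z‖ < 1 := fun hz => mem_ball_zero_iff.1 hz
  have hM : ∀ {z : ℂ}, ‖z‖ < 1 → ‖nomeFun z‖ < 1 := fun hz => (norm_nomeFun_le hz).trans_lt hz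
  have a1 : AnalyticOnNhd ℂ (fun x => x * (1 - x) * hypF x ^ 6) (Metric.ball 0 1) :=
    DifferentiableOn.analyticOnNhd (fun z hz => ((differentiableAt_id.mul
      (differentiableAt_id.const_sub 1)).mul
      ((differentiableAt_hypF (hball hz)).pow 6)).differentiableWithinAt) Metric.isOpen_ball
  have a2 : AnalyticOnNhd ℂ (fun x => 27 * nomeFun x * eulerFun (nomeFun x) ^ 6 *
      eulerFun (nomeFun x ^ 3) ^ 6) (Metric.ball 0 1) := by
    refine DifferentiableOn.analyticOnNhd (fun z hz => ?_) Metric.isOpen_ball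
    have h1 := differentiableAt_nomeFun (hball hz)
    have h2 : DifferentiableAt ℂ (fun x => eulerFun (nomeFun x)) z :=
      (differentiableAt_eulerFun (hM (hball hz))).comp z h1
    have h3 : DifferentiableAt ℂ (fun x => eulerFun (nomeFun x ^ 3)) z :=
      DifferentiableAt.comp z (differentiableAt_eulerFun
        (norm_pow_lt_one (hM (hball hz)) (by norm_num))) (h1.pow 3)
    exact (((h1.const_mul 27).mul (h2.pow 6)).mul (h3.pow 6)).differentiableWithinAt
  have hne : ∀ᶠ q in 𝓝[≠] (0 : ℂ), nomeMod q ≠ 0 := by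
    filter_upwards [nhdsWithin_le_nhds (continuousAt_nomeModUnit.eventually_ne
      (by rw [nomeModUnit_zero]; exact one_ne_zero : nomeModUnit 0 ≠ 0)), self_mem_nhdsWithin]
      with q h1 h2
    rw [nomeMod_eq_mul]
    exact mul_ne_zero (mul_ne_zero (by norm_num) h2) h1
  have hlim : Tendsto nomeMod (𝓝[≠] 0) (𝓝[≠] 0) := by
    refine tendsto_nhdsWithin_iff.2 ⟨?_, hne⟩
    have := continuousAt_nomeMod.tendsto
    rw [nomeMod_zero] at this
    exact this.mono_left nhdsWithin_le_nhds
  -- At x = c^3/a^3 one has 1 - x = b^3/a^3 and F^6 = a^6, so both sides are b^3 c^3. Such x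
  -- accumulate at 0, as the identity theorem needs.
  have hev : ∀ᶠ q in 𝓝[≠] (0 : ℂ), nomeMod q * (1 - nomeMod q) * hypF (nomeMod q) ^ 6 =
      27 * nomeFun (nomeMod q) * eulerFun (nomeFun (nomeMod q)) ^ 6 *
      eulerFun (nomeFun (nomeMod q) ^ 3) ^ 6 := by
    filter_upwards [nhdsWithin_le_nhds hypF_nomeMod,
      nhdsWithin_le_nhds (Metric.ball_mem_nhds (0 : ℂ) one_pos)] with q hq hq1
    obtain ⟨hN, hF, hn⟩ := hq
    have hq1' := hball hq1
    have h1 := eulerFun_ne_zero hq1'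
    have h3 := eulerFun_ne_zero (norm_pow_lt_one hq1' (n := 3) (by norm_num))
    rw [hn, show hypF (nomeMod q) ^ 6 = (hypF (nomeMod q) ^ 3) ^ 2 by ring, hF]
    have e : 1 - nomeMod q = eulerFun q ^ 9 / eulerFun (q ^ 3) ^ 3 / borweinCube q := by
      rw [nomeMod, eq_div_iff hN, sub_mul, one_mul]
      nth_rewrite 1 [borweinCube]
      field_simp
      ring
    rw [e, nomeMod]
    field_simp
  exact a1.eqOn_of_preconnected_of_frequently_eq a2 (convex_ball 0 1).isPreconnected
    (Metric.mem_ball_self one_pos) (hlim.frequently hev.frequently) (mem_ball_zero_iff.2 hx)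

/-! ### The statement in terms of `q` -/

theorem hypCoeff_mul_pow (q : ℂ) (n : ℕ) : (hypCoeff n : ℂ) * (-27 * q) ^ n =
    (-1) ^ n * (((3 * n).factorial : ℂ) / (n.factorial : ℂ) ^ 3) * q ^ n := by
  have h : (n.factorial : ℂ) ≠ 0 := by exact_mod_cast n.factorial_ne_zero
  rw [hypCoeff, mul_pow, show (-27 : ℂ) = -1 * 27 by norm_num, mul_pow]
  push_cast
  field_simp

theorem I11_eq (q : ℂ) : I11 q = hypF (-27 * q) :=
  tsum_congr fun n => (hypCoeff_mul_pow q n).symm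

theorem three_mul_J11_eq (q : ℂ) : 3 * J11 q = hypG (-27 * q) := by
  rw [J11, ← tsum_mul_left]
  refine tsum_congr fun n => ?_
  have h := hypCoeff_mul_pow q n
  simp only [harmCoeff]
  push_cast
  linear_combination (-3 * ∑ s ∈ Icc (n + 1) (3 * n), (1 : ℂ) / s) * h

theorem modularCoord_eq (q : ℂ) : modularCoord q = nomeFun (-27 * q) := by
  rw [modularCoord, nomeFun, I11_eq, three_mul_J11_eq]
  ring

theorem eta_eq (τ : ℂ) : ModularForm.eta τ = Complex.exp (2 * Real.pi * Complex.I * τ / 24) *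
    eulerFun (Complex.exp (2 * Real.pi * Complex.I * τ)) := by
  rw [ModularForm.eta, eulerFun, Function.Periodic.qParam]
  congr 1
  exact tprod_congr fun n => by rw [ModularForm.eta_q_eq_pow]

theorem theta2_pi_div_six {τ : ℂ} (hτ : ‖Complex.exp (2 * Real.pi * Complex.I * τ)‖ < 1) :
    theta2 (Real.pi / 6) τ = Real.sqrt 3 * Complex.exp (Real.pi * Complex.I * τ / 4) *
      eulerFun (Complex.exp (2 * Real.pi * Complex.I * τ) ^ 3) := by
  rw [eulerFun_cube_eq_tsum hτ, theta2, ← tsum_mul_left, ← tsum_mul_left]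
  refine tsum_congr fun n => ?_
  rw [← chebSeq_one, ← Complex.exp_nat_mul]
  have h : (2 : ℂ) * (tri n : ℂ) = n * (n + 1) := by exact_mod_cast two_mul_tri n
  have e : Complex.exp (Real.pi * Complex.I * τ * ((n : ℂ) + 1 / 2) ^ 2) =
      Complex.exp (Real.pi * Complex.I * τ / 4) *
      Complex.exp (tri n * (2 * Real.pi * Complex.I * τ)) := by
    rw [← Complex.exp_add]
    congr 1
    linear_combination (-Real.pi * Complex.I * τ) * h
  rw [e]
  ring

/-- Squaring combines the fractional powers 𝔮^{3/8} and 𝔮^{1/8} into 𝔮 itself, so the result does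
not depend on the choice of τ. -/
theorem dFun_mul_eta_sq {q τ : ℂ} (hq : ‖q‖ < 1 / 27)
    (hτ : Complex.exp (2 * Real.pi * Complex.I * τ) = modularCoord q) :
    (dFun τ * ModularForm.eta τ ^ 3) ^ 2 = -27 * (q * (1 + 27 * q) * I11 q ^ 6) := by
  have hx : ‖-27 * q‖ < 1 := by
    rw [norm_mul, norm_neg, Complex.norm_ofNat]; linarith
  rw [modularCoord_eq] at hτ
  have h1 : ‖Complex.exp (2 * Real.pi * Complex.I * τ)‖ < 1 := by
    rw [hτ]; exact (norm_nomeFun_le hx).trans_lt hx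
  have key := mul_hypF_pow_six hx
  rw [dFun, theta2_pi_div_six h1, eta_eq, I11_eq]
  have hs : ((Real.sqrt 3 : ℝ) : ℂ) ^ 2 = 3 := by
    rw [← Complex.ofReal_pow, Real.sq_sqrt (by norm_num)]; norm_num
  have he : Complex.exp (Real.pi * Complex.I * τ / 4) ^ 6 *
      Complex.exp (2 * Real.pi * Complex.I * τ / 24) ^ 6 = nomeFun (-27 * q) := by
    rw [← hτ, ← Complex.exp_nat_mul, ← Complex.exp_nat_mul, ← Complex.exp_add]
    congr 1
    push_cast
    ring
  rw [hτ]
  calc _ = (((Real.sqrt 3 : ℝ) : ℂ) ^ 2) ^ 3 * (Complex.exp (Real.pi * Complex.I * τ / 4) ^ 6 *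
      Complex.exp (2 * Real.pi * Complex.I * τ / 24) ^ 6) *
      eulerFun (nomeFun (-27 * q)) ^ 6 * eulerFun (nomeFun (-27 * q) ^ 3) ^ 6 := by ring
    _ = 27 * nomeFun (-27 * q) * eulerFun (nomeFun (-27 * q)) ^ 6 *
      eulerFun (nomeFun (-27 * q) ^ 3) ^ 6 := by rw [hs, he]; norm_num
    _ = _ := by rw [← key]; ring

/-- Differences of values of f lie in the discrete set 2πiℤ, and a continuous map from a
preconnected set to a discrete one is constant. -/
theorem eq_of_exp_eq_const {U : Set ℂ} (hU : IsPreconnected U) {f : ℂ → ℂ} {c : ℂ}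
    (hf : ContinuousOn f U) (h : ∀ q ∈ U, Complex.exp (f q) = c) {p q : ℂ} (hp : p ∈ U)
    (hq : q ∈ U) : f p = f q := by
  have hpi : (2 * Real.pi * Complex.I : ℂ) ≠ 0 := Complex.two_pi_I_ne_zero
  have hint : ∀ z ∈ U, ∃ n : ℤ, (f z - f q) / (2 * Real.pi * Complex.I) = n := by
    intro z hz
    obtain ⟨n, hn⟩ := Complex.exp_eq_exp_iff_exists_int.1 ((h z hz).trans (h q hq).symm)
    exact ⟨n, by rw [hn]; field_simp; ring⟩
  have hcont : ContinuousOn (fun z => ((f z - f q) / (2 * Real.pi * Complex.I)).re) U :=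
    Complex.continuous_re.comp_continuousOn ((hf.sub continuousOn_const).div_const _)
  have hsub : ∀ z ∈ U, ((f z - f q) / (2 * Real.pi * Complex.I)).re =
      ((f q - f q) / (2 * Real.pi * Complex.I)).re := by
    intro z hz
    refine hU.constant_of_mapsTo (T := Set.range ((↑) : ℤ → ℝ)) ?_ hcont (fun w hw => ?_) hz hq
    · exact ⟨Int.isClosedEmbedding_coe_real.isEmbedding.toHomeomorph.discreteTopology⟩
    · obtain ⟨n, hn⟩ := hint w hw
      exact ⟨n, by simp [hn]⟩
  obtain ⟨n, hn⟩ := hint p hp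
  have h1 := hsub p hp
  rw [hn, sub_self, zero_div, Complex.intCast_re, Complex.zero_re, Int.cast_eq_zero] at h1
  rw [h1, Int.cast_zero, div_eq_zero_iff, sub_eq_zero] at hn
  exact hn.resolve_right hpi

end LocalP2

/-- On the punctured disc `0 < |q| < 1/27`, all quantities under the logarithms are nonzero and
`0 < |𝔮| < 1`; and on every connected subset, whatever branches of the logarithms and of `τ` are
chosen, `F₁ = -(1/6) log (d(𝔮) η(𝔮)^3)` up to an additive constant. -/
theorem mainTheorem9 :
    (∀ q : ℂ, 0 < ‖q‖ → ‖q‖ < 1 / 27 →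
      LocalP2.I11 q ≠ 0 ∧ 0 < ‖LocalP2.modularCoord q‖ ∧ ‖LocalP2.modularCoord q‖ < 1 ∧
      ∀ τ : ℂ, Complex.exp (2 * Real.pi * Complex.I * τ) = LocalP2.modularCoord q →
        LocalP2.dFun τ * ModularForm.eta τ ^ 3 ≠ 0) ∧
    (∀ U : Set ℂ, IsPreconnected U → (∀ q ∈ U, 0 < ‖q‖ ∧ ‖q‖ < 1 / 27) →
      ∀ F τ L : ℂ → ℂ,
        LocalP2.IsGenusOneFreeEnergyOn U F →
        LocalP2.IsModularParameterOn U τ →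
        LocalP2.IsLogOn U (fun q => LocalP2.dFun (τ q) * ModularForm.eta (τ q) ^ 3) L →
        ∃ C : ℂ, ∀ q ∈ U, F q = -(1 / 6) * L q + C) := by
  constructor
  · intro q hq0 hq
    have hx : ‖-27 * q‖ < 1 := by
      rw [norm_mul, norm_neg, Complex.norm_ofNat]; linarith
    have hq0' : q ≠ 0 := norm_pos_iff.1 hq0
    have hI : LocalP2.I11 q ≠ 0 := by
      rw [LocalP2.I11_eq]; exact LocalP2.hypF_ne_zero hx
    refine ⟨hI, ?_, ?_, fun τ hτ h => ?_⟩
    · rw [LocalP2.modularCoord_eq, norm_pos_iff]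
      exact LocalP2.nomeFun_ne_zero (mul_ne_zero (by norm_num) hq0')
    · rw [LocalP2.modularCoord_eq]
      exact (LocalP2.norm_nomeFun_le hx).trans_lt hx
    · have e := LocalP2.dFun_mul_eta_sq hq hτ
      rw [h] at e
      have h1 : 1 + 27 * q ≠ 0 := by
        have := LocalP2.one_sub_ne_zero_of_norm_lt_one hx
        rwa [neg_mul, sub_neg_eq_add] at this
      refine mul_ne_zero (by norm_num : (-27 : ℂ) ≠ 0)
        (mul_ne_zero (mul_ne_zero hq0' h1) (pow_ne_zero 6 hI)) (e.symm.trans ?_)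
      norm_num
  · rintro U hU hUq F τ L ⟨a, b, c, ⟨ha, ha'⟩, ⟨hb, hb'⟩, ⟨hc, hc'⟩, hF⟩ ⟨-, hτ⟩ ⟨hL, hL'⟩
    rcases U.eq_empty_or_nonempty with rfl | ⟨p, hp⟩
    · exact ⟨0, fun q hq => absurd hq (Set.notMem_empty q)⟩
    have hcont : ContinuousOn (fun q => 2 * L q - (a q + 6 * b q + c q)) U :=
      (continuousOn_const.mul hL).sub ((ha.add (continuousOn_const.mul hb)).add hc)
    -- The combination is 12 times `(1/6) L + F` up to sign, namely 2L + 12F, so its constancy is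
    -- the claim.
    have hexp : ∀ q ∈ U, Complex.exp (2 * L q - (a q + 6 * b q + c q)) = -27 := by
      intro q hq
      have hq27 : ‖-27 * q‖ < 1 := by
        rw [norm_mul, norm_neg, Complex.norm_ofNat]; linarith [(hUq q hq).2]
      have e := LocalP2.dFun_mul_eta_sq (hUq q hq).2 (hτ q hq)
      have h1 : 1 + 27 * q ≠ 0 := by
        have := LocalP2.one_sub_ne_zero_of_norm_lt_one hq27
        rwa [neg_mul, sub_neg_eq_add] at this
      have hI : LocalP2.I11 q ≠ 0 := by
        rw [LocalP2.I11_eq]; exact LocalP2.hypF_ne_zero hq27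
      have hq0 : q ≠ 0 := norm_pos_iff.1 (hUq q hq).1
      have e2 : Complex.exp (2 * L q) = (Complex.exp (L q)) ^ 2 := by
        rw [← Complex.exp_nat_mul]; norm_num
      have e6 : Complex.exp (6 * b q) = (Complex.exp (b q)) ^ 6 := by
        rw [← Complex.exp_nat_mul]; norm_num
      rw [Complex.exp_sub, Complex.exp_add, Complex.exp_add, e2, e6, ha' q hq, hb' q hq, hc' q hq,
        hL' q hq, e]
      field_simp
    refine ⟨F p + 1 / 6 * L p, fun q hq => ?_⟩
    have h := LocalP2.eq_of_exp_eq_const hU hcont hexp hq hp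
    rw [hF q hq, hF p hp]
    linear_combination (1 / 12 : ℂ) * h
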